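/- Let $n\ge 1$. On $\mathbb R^{n+1}$ put $\langle x,y\rangle=-x_0y_0+x_1y_1+\cdots+x_ny_n$. Let $I^n=\{x:\langle x,x\rangle=-1,\ x_0>0\}$ be the hyperboloid model of hyperbolic $n$-space, with distance $d(x,y)=\operatorname{arcosh}(-\langle x,y\rangle)$, and let $\mathrm{dS}^n=\{u:\langle u,u\rangle=1\}$ be de Sitter space. For $u\in\mathrm{dS}^n$ put $P_u=\{x\in I^n:\langle x,u\rangle=0\}$. Let $\Omega$ be the set of totally geodesic hyperplanes of $I^n$, i.e. of the nonempty connected embedded smooth submanifolds $P\subset I^n$ of dimension $n-1$ such that every complete geodesic of $I^n$ that is tangent to $P$ at a point of $P$ is contained in $P$. Then the following hold. 1. Every $P_u$ belongs to $\Omega$, and $u\mapsto P_u$ induces a bijection $\mathrm{dS}^n/\{\pm1\}\to\Omega$. (The measurable structure of $\Omega$ is the quotient one: $A\subseteq\Omega$ is measurable iff $\{u: P_u\in A\}$ is Borel.) 2. The map $(r,\omega)\mapsto(\sinh r,\cosh r\,\omega)$ is a homeomorphism of $\mathbb R\times S^{n-1}$ onto $\mathrm{dS}^n$. In these coordinates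 the volume measure $\sqrt{|\det g_{\mathrm{dS}}|}\,dx_1\cdots dx_n$ of the Lorentzian metric $g_{\mathrm{dS}}$ induced on $\mathrm{dS}^n$ by $\langle\cdot,\cdot\rangle$ is $$d\mu(r,\omega)=\cosh^{n-1}r\,dr\,d\omega,$$ where $d\omega$ is the surface measure of the unit sphere $S^{n-1}$. 3. This measure on $\mathrm{dS}^n$ is invariant under the group $O(n,1)$ of all linear automorphisms of $\mathbb R^{n+1}$ preserving $\langle\cdot,\cdot\rangle$, in particular under $SO(n,1)$. Equivalently, its image $\mu$ on $\Omega$ under $u\mapsto P_u$ is invariant under the action of $O(n,1)$ on hyperplanes, where $g\in O(n,1)$ acts on $I^n$ by sending $x$ to whichever of $gx$, $-gx$ lies in $I^n$, and this action maps $\Omega$ to $\Omega$. 4. There is a constant $c=c(n)>0$ such that for all $x,y\in I^n$ the set of $H\in\Omega$ that separate $x$ and $y$ (that is, $x$ and $y$ lie in different connected components of $I^n\setminus H$) is measurable and $$\mu(\{H\in\Omega: H\text{ separates }x\text{ and }y\})=c\,d(x,y).$$ -/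

import Mathlib

open Set Filter Topology MeasureTheory
open scoped ContDiff ENNReal

noncomputable section

namespace HyperbolicWalls

/-- The vector space `ℝ^{n+1}`, with coordinates `x 0, x 1, …, x n`. -/
abbrev E (n : ℕ) : Type := Fin (n + 1) → ℝ

/-- The Lorentzian form `⟨x, y⟩ = -x₀ y₀ + x₁ y₁ + ⋯ + xₙ yₙ`. -/
def form {n : ℕ} (x y : E n) : ℝ := -(x 0 * y 0) + ∑ i : Fin n, x i.succ * y i.succ

/-- Hyperbolic space `Iⁿ` (the upper sheet of the hyperboloid). -/
def Hyp (n : ℕ) : Set (E n) := {x | form x x = -1 ∧ 0 < x 0}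

/-- The hyperbolic distance on `Iⁿ`. -/
def hypDist {n : ℕ} (x y : E n) : ℝ := Real.arcosh (-form x y)

/-- The unit-speed geodesic of `Iⁿ` that starts at `p ∈ Iⁿ` with velocity `v`, where `v` is a unit
tangent vector at `p`, i.e. `⟨p, v⟩ = 0` and `⟨v, v⟩ = 1`. -/
def geodesic {n : ℕ} (p v : E n) (t : ℝ) : E n := Real.cosh t • p + Real.sinh t • v

/-- De Sitter space `dSⁿ`. -/
def dS (n : ℕ) : Set (E n) := {u | form u u = 1}

/-- `P_u = u^⊥ ∩ Iⁿ`. -/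
def polar {n : ℕ} (u : E n) : Set (E n) := {x ∈ Hyp n | form x u = 0}

/-- Near `p`, the set `P` is the smooth hypersurface `{f = 0}` of `Iⁿ`: `f` is smooth near `p`,
its differential does not vanish identically on the tangent space `T_p Iⁿ = p^⊥`, and `P`
coincides with the zero set of `f` in a neighbourhood of `p` in `Iⁿ`.
The tangent space of `P` at `p` is then `{v | ⟨p, v⟩ = 0, df_p v = 0}`. -/
structure IsDefiningFunctionAt {n : ℕ} (P : Set (E n)) (p : E n) (f : E n → ℝ) : Prop where
  smooth : ContDiffAt ℝ ∞ f p
  regular : ∃ v, form p v = 0 ∧ fderiv ℝ f p v ≠ 0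
  zeroSet : ∀ᶠ x in 𝓝[Hyp n] p, x ∈ P ↔ f x = 0

/-- `P` is a totally geodesic hyperplane of `Iⁿ`: a (nonempty) connected embedded smooth
submanifold of `Iⁿ` of dimension `n - 1` that contains every complete geodesic of `Iⁿ` that is
tangent to it at one of its points. -/
structure IsTotallyGeodesicHyperplane {n : ℕ} (P : Set (E n)) : Prop where
  subset : P ⊆ Hyp n
  connected : IsConnected P
  totallyGeodesic : ∀ p ∈ P, ∃ f : E n → ℝ, IsDefiningFunctionAt P p f ∧
    ∀ v, form p v = 0 → form v v = 1 → fderiv ℝ f p v = 0 → ∀ t : ℝ, geodesic p v t ∈ P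

/-- The space `Ω` of totally geodesic hyperplanes of `Iⁿ`. -/
def Om (n : ℕ) : Type := {P : Set (E n) // IsTotallyGeodesicHyperplane P}

instance (n : ℕ) : CoeOut (Om n) (Set (E n)) := ⟨Subtype.val⟩

/-- `H` separates `x` and `y`: the two points lie in different connected components of `Iⁿ \ H`. -/
def Separates {n : ℕ} (H : Set (E n)) (x y : E n) : Prop :=
  x ∈ Hyp n \ H ∧ y ∈ Hyp n \ H ∧ y ∉ connectedComponentIn (Hyp n \ H) x

/-! Helper facts: each `P_u` with `u ∈ dSⁿ` is a totally geodesic hyperplane. -/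

theorem form_comm {n : ℕ} (x y : E n) : form x y = form y x := by
  simp [form, mul_comm]

theorem form_add_left {n : ℕ} (x y z : E n) : form (x + y) z = form x z + form y z := by
  simp only [form, Pi.add_apply, add_mul, Finset.sum_add_distrib]; ring

theorem form_smul_left {n : ℕ} (a : ℝ) (x z : E n) : form (a • x) z = a * form x z := by
  simp only [form, Pi.smul_apply, smul_eq_mul, mul_add, Finset.mul_sum, mul_assoc]; ring

theorem form_add_right {n : ℕ} (x y z : E n) : form z (x + y) = form z x + form z y := by
  rw [form_comm, form_add_left, form_comm x, form_comm y]

theorem form_smul_right {n : ℕ} (a : ℝ) (x z : E n) : form z (a • x) = a * form z x := by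
  rw [form_comm, form_smul_left, form_comm]

/-- The linear functional `⟨·, u⟩`. -/
def formCLM {n : ℕ} (u : E n) : E n →L[ℝ] ℝ :=
  LinearMap.toContinuousLinearMap
    { toFun := fun x => form x u
      map_add' := fun x y => form_add_left x y u
      map_smul' := fun a x => form_smul_left a x u }

theorem formCLM_apply {n : ℕ} (u x : E n) : formCLM u x = form x u := rfl

theorem continuous_form {n : ℕ} : Continuous fun z : E n × E n => form z.1 z.2 := by
  unfold form; fun_prop

theorem form_neg_of_mem {n : ℕ} {x y : E n} (hx : x ∈ Hyp n) (hy : y ∈ Hyp n) :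
    form x y < 0 := by
  obtain ⟨hx1, hx0⟩ := hx
  obtain ⟨hy1, hy0⟩ := hy
  have hcs := Finset.sum_mul_sq_le_sq_mul_sq Finset.univ
    (fun i : Fin n => x i.succ) (fun i : Fin n => y i.succ)
  have hX : ∑ i : Fin n, x i.succ ^ 2 = x 0 ^ 2 - 1 := by
    simp only [form, ← pow_two] at hx1; linarith
  have hY : ∑ i : Fin n, y i.succ ^ 2 = y 0 ^ 2 - 1 := by
    simp only [form, ← pow_two] at hy1; linarith
  have hX0 : 0 ≤ x 0 ^ 2 - 1 := hX ▸ Finset.sum_nonneg fun i _ => sq_nonneg _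
  have hY0 : 0 ≤ y 0 ^ 2 - 1 := hY ▸ Finset.sum_nonneg fun i _ => sq_nonneg _
  rw [hX, hY] at hcs
  have h : (∑ i : Fin n, x i.succ * y i.succ) < x 0 * y 0 := by
    refine lt_of_pow_lt_pow_left₀ 2 (by positivity) ?_
    nlinarith
  simp only [form]; linarith

/-- Points with `⟨z, z⟩ < 0` and `z₀ > 0`, scaled into `Iⁿ`. -/
theorem normalize_mem {n : ℕ} {z : E n} (h : form z z < 0) (h0 : 0 < z 0) :
    (Real.sqrt (-form z z))⁻¹ • z ∈ Hyp n := by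
  have hs : 0 < Real.sqrt (-form z z) := Real.sqrt_pos.2 (by linarith)
  refine ⟨?_, ?_⟩
  · rw [form_smul_left, form_smul_right]
    have := Real.sq_sqrt (show 0 ≤ -form z z by linarith)
    field_simp
    linarith
  · simp only [Pi.smul_apply, smul_eq_mul]; positivity

theorem polar_nonempty {n : ℕ} {u : E n} (hu : u ∈ dS n) : (polar u).Nonempty := by
  have hu1 : form u u = 1 := hu
  let e : E n := Pi.single 0 1
  have he : form e e = -1 := by simp [e, form]
  have heu : form e u = -(u 0) := by simp [e, form]
  set z : E n := e + u 0 • u with hz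
  have hzu : form z u = 0 := by
    rw [hz, form_add_left, form_smul_left, heu, hu1]; ring
  have hzz : form z z = -1 - u 0 ^ 2 := by
    rw [hz, form_add_right, form_smul_right, ← hz, hzu, hz, form_add_left, form_smul_left, he,
      form_comm u, heu]; ring
  have hz0 : 0 < z 0 := by simp [hz, e]; nlinarith [mul_self_nonneg (u 0)]
  refine ⟨_, normalize_mem (by nlinarith) hz0, ?_⟩
  rw [form_smul_left, hzu, mul_zero]

theorem polar_isConnected {n : ℕ} {u : E n} (hu : u ∈ dS n) : IsConnected (polar u) := by
  refine ⟨polar_nonempty hu, ?_⟩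
  refine isPreconnected_of_forall_pair fun x hx y hy => ?_
  let seg : ℝ → E n := fun t => (1 - t) • x + t • y
  have hxy := form_neg_of_mem hx.1 hy.1
  have hneg : ∀ t ∈ Icc (0 : ℝ) 1, form (seg t) (seg t) < 0 := by
    intro t ht
    simp only [seg, form_add_left, form_add_right, form_smul_left, form_smul_right, hx.1.1, hy.1.1,
      form_comm y x]
    have h1 : 0 ≤ t * (1 - t) := mul_nonneg ht.1 (by linarith [ht.2])
    nlinarith [mul_nonneg h1 (neg_nonneg.2 hxy.le), sq_nonneg (2 * t - 1)]
  have hpos : ∀ t ∈ Icc (0 : ℝ) 1, 0 < seg t 0 := by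
    intro t ht
    simp only [seg, Pi.add_apply, Pi.smul_apply, smul_eq_mul]
    rcases eq_or_lt_of_le ht.1 with h | h
    · subst h; simpa using hx.1.2
    · have := mul_pos h hy.1.2
      have := mul_nonneg (sub_nonneg.2 ht.2) hx.1.2.le
      linarith
  let c : ℝ → E n := fun t => (Real.sqrt (-form (seg t) (seg t)))⁻¹ • seg t
  have hseg : Continuous seg := by fun_prop
  have hcont : ContinuousOn c (Icc 0 1) := by
    have h1 : Continuous fun t => Real.sqrt (-form (seg t) (seg t)) :=
      (continuous_form.comp (hseg.prodMk hseg)).neg.sqrt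
    refine (h1.continuousOn.inv₀ fun t ht => ?_).smul hseg.continuousOn
    exact (Real.sqrt_pos.2 (by linarith [hneg t ht])).ne'
  refine ⟨c '' Icc 0 1, ?_, ⟨0, by simp, ?_⟩, ⟨1, by simp, ?_⟩,
    isPreconnected_Icc.image c hcont⟩
  · rintro _ ⟨t, ht, rfl⟩
    refine ⟨normalize_mem (hneg t ht) (hpos t ht), ?_⟩
    simp only [c, seg, form_smul_left, form_add_left, hx.2, hy.2]; ring
  · simp [c, seg, hx.1.1]
  · simp [c, seg, hy.1.1]

theorem geodesic_mem_hyp {n : ℕ} {p v : E n} (hp : p ∈ Hyp n) (hpv : form p v = 0)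
    (hv : form v v = 1) (t : ℝ) : geodesic p v t ∈ Hyp n := by
  have h1 : form (geodesic p v t) (geodesic p v t) = -1 := by
    simp only [geodesic, form_add_left, form_add_right, form_smul_left, form_smul_right, hpv,
      form_comm v p, hv, hp.1]
    nlinarith [Real.cosh_sq t]
  have h2 : form p (geodesic p v t) = -Real.cosh t := by
    simp only [geodesic, form_add_right, form_smul_right, hpv, hp.1]; ring
  refine ⟨h1, ?_⟩
  by_contra hneg
  have hle : geodesic p v t 0 ≤ 0 := not_lt.1 hneg
  have hne : geodesic p v t 0 ≠ 0 := by
    intro h0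
    have : (0 : ℝ) ≤ form (geodesic p v t) (geodesic p v t) := by
      simp only [form, h0, mul_zero, neg_zero, zero_add]
      exact Finset.sum_nonneg fun i _ => mul_self_nonneg _
    linarith
  have hmem : (-1 : ℝ) • geodesic p v t ∈ Hyp n := by
    refine ⟨by rw [form_smul_left, form_smul_right, h1]; ring, ?_⟩
    simp only [Pi.smul_apply, smul_eq_mul]
    have := lt_of_le_of_ne hle hne
    linarith
  have := form_neg_of_mem hp hmem
  rw [form_smul_right, h2] at this
  linarith [Real.cosh_pos t]

theorem polar_isTotallyGeodesicHyperplane {n : ℕ} {u : E n} (hu : u ∈ dS n) :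
    IsTotallyGeodesicHyperplane (polar u) where
  subset := fun _ hx => hx.1
  connected := polar_isConnected hu
  totallyGeodesic := by
    intro p hp
    have hf : ∀ x, fderiv ℝ (fun x => form x u) x = formCLM u := fun x => (formCLM u).fderiv
    refine ⟨fun x => form x u, ⟨(formCLM u).contDiff.contDiffAt, ⟨u, hp.2, ?_⟩, ?_⟩, ?_⟩
    · rw [hf, formCLM_apply, show form u u = 1 from hu]; exact one_ne_zero
    · filter_upwards [self_mem_nhdsWithin] with x hx
      exact ⟨fun h => h.2, fun h => ⟨hx, h⟩⟩
    · intro v hpv hv hd t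
      rw [hf, formCLM_apply] at hd
      refine ⟨geodesic_mem_hyp hp.1 hpv hv t, ?_⟩
      simp only [geodesic, form_add_left, form_smul_left, hp.2, hd]; ring

/-- The map `dSⁿ → Ω`, `u ↦ P_u`. -/
def toOm {n : ℕ} (u : dS n) : Om n := ⟨polar u, polar_isTotallyGeodesicHyperplane u.2⟩

/-- The equivalence relation `u ∼ ±u` on `dSⁿ`; its quotient is `dSⁿ/{±1}`. -/
def signSetoid (n : ℕ) : Setoid (dS n) where
  r u v := (u : E n) = v ∨ (u : E n) = -v
  iseqv :=
    { refl := fun _ => Or.inl rfl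
      symm := by
        rintro u v (h | h)
        · exact Or.inl h.symm
        · exact Or.inr (by rw [h, neg_neg])
      trans := by
        rintro u v w (h | h) (h' | h')
        · exact Or.inl (h.trans h')
        · exact Or.inr (h.trans h')
        · exact Or.inr (by rw [h, h'])
        · exact Or.inl (by rw [h, h', neg_neg]) }

/-- The measurable structure of `Ω` as a quotient of `dSⁿ` (with its Borel sets) under
`u ↦ P_u`: a set `A ⊆ Ω` is measurable iff `{u | P_u ∈ A}` is Borel. -/
instance (n : ℕ) : MeasurableSpace (Om n) := MeasurableSpace.map toOm inferInstance

/-- The unit sphere `S^{n-1}` of Euclidean `ℝⁿ`. -/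
abbrev Sph (n : ℕ) : Type := Metric.sphere (0 : EuclideanSpace ℝ (Fin n)) 1

/-- The parametrization `u(r, ω) = (sinh r, cosh r ω)` of `dSⁿ`. -/
def param (n : ℕ) (z : ℝ × Sph n) : dS n :=
  ⟨Fin.cons (Real.sinh z.1) fun i => Real.cosh z.1 * z.2.1 i, by
    have h : ∑ i, (z.2.1 i) ^ 2 = 1 := by
      have h2 := EuclideanSpace.norm_sq_eq z.2.1
      rw [mem_sphere_zero_iff_norm.1 z.2.2] at h2
      simpa using h2.symm
    have h3 : ∑ i, Real.cosh z.1 * z.2.1 i * (Real.cosh z.1 * z.2.1 i)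
        = Real.cosh z.1 ^ 2 * ∑ i, (z.2.1 i) ^ 2 := by
      rw [Finset.mul_sum]; exact Finset.sum_congr rfl fun i _ => by ring
    simp only [dS, mem_ofPred_eq, form, Fin.cons_zero, Fin.cons_succ, h3, h]
    nlinarith [Real.cosh_sq z.1]⟩

/-- The measure `cosh^{n-1} r dr dω` on `dSⁿ`; here `dω` is the surface measure of `S^{n-1}`. -/
def muDS (n : ℕ) : Measure (dS n) :=
  Measure.map (param n)
    (((volume : Measure ℝ).prod (volume : Measure (EuclideanSpace ℝ (Fin n))).toSphere).withDensity
      fun z => ENNReal.ofReal (Real.cosh z.1 ^ (n - 1)))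

/-- The measure `μ` induced by `cosh^{n-1} r dr dω` on `Ω`: `μ A` is the measure of
`{u ∈ dSⁿ | P_u ∈ A}`. -/
def mu (n : ℕ) : Measure (Om n) := Measure.map toOm (muDS n)

/-- `ν` is the (unsigned) volume measure of the Lorentzian metric induced on `dSⁿ` by the form:
in every injective `C¹` parametrization `φ : U → dSⁿ`, `U ⊆ ℝⁿ` open, it is
`√|det g| dx₁ ⋯ dxₙ`, where `g i j = ⟨∂ᵢφ, ∂ⱼφ⟩`. -/
def IsVolumeMeasure {n : ℕ} (ν : Measure (dS n)) : Prop :=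
  ∀ (U : Set (Fin n → ℝ)) (φ : (Fin n → ℝ) → E n), IsOpen U → ContDiffOn ℝ 1 φ U → InjOn φ U →
    MapsTo φ U (dS n) →
    ν {u | (u : E n) ∈ φ '' U} = ∫⁻ x in U, ENNReal.ofReal (Real.sqrt |Matrix.det
      (Matrix.of fun i j : Fin n =>
        form (fderiv ℝ φ x (Pi.single i 1)) (fderiv ℝ φ x (Pi.single j 1)))|)

/-- The Lorentz group `O(n,1)` of all linear automorphisms of `ℝ^{n+1}` that preserve the form. -/
def lorentzGroup (n : ℕ) : Subgroup (E n ≃ₗ[ℝ] E n) where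
  carrier := {g | ∀ x y, form (g x) (g y) = form x y}
  mul_mem' := fun {g h} hg hh x y => by
    rw [LinearEquiv.mul_apply, LinearEquiv.mul_apply, hg, hh]
  one_mem' := fun _ _ => rfl
  inv_mem' := fun {g} hg x y => by
    have := hg (g⁻¹ x) (g⁻¹ y)
    rw [← LinearEquiv.mul_apply, ← LinearEquiv.mul_apply, mul_inv_cancel] at this
    exact this.symm

/-- The linear action of `O(n,1)` on `dSⁿ`. -/
def actDS {n : ℕ} (g : lorentzGroup n) (u : dS n) : dS n :=
  ⟨g.1 u, (g.2 u u).trans u.2⟩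

/-- The action of `O(n,1)` on `Iⁿ`: `x` goes to that one of the points `g x`, `-g x` which lies on
the upper sheet. This is just `g x` if `g` preserves the upper sheet. -/
def actHyp {n : ℕ} (g : lorentzGroup n) (x : E n) : E n :=
  if 0 < g.1 x 0 then g.1 x else -(g.1 x)

end HyperbolicWalls

end

open HyperbolicWalls

/-!
The whole theorem rests on one observation: for a Borel set `A ⊆ dSⁿ`, the measure
`cosh^{n-1} r dr dω` of `A` equals `n + 1` times the Lebesgue measure of the truncated cone
`{t u | 0 < t < 1, u ∈ A}` in `ℝ^{n+1}` (`muDS_apply`). This follows from spherical coordinates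
`ρ ω` in the spacelike coordinates and the substitution `(x₀, ρ) = (t sinh r, t cosh r)`, which turn
Lebesgue measure into `tⁿ cosh^{n-1} r dt dr dω`.

* Lorentz invariance is then immediate, because a linear map preserving the form has determinant
  `±1` and so preserves Lebesgue measure (`measurePreserving_actDS`).
* For a chart `φ` of `dSⁿ`, the cone over its image is parametrized by `(t, x) ↦ t φ(x)`. The Gram
  matrix of the partial derivatives is block diagonal, with blocks `1` and `t² g`, whence the Jacobian
  is `tⁿ √|det g|`, and integrating out `t` gives the volume measure (`isVolumeMeasure_muDS`).

A totally geodesic hyperplane `P` contains all geodesics issuing from a point `p ∈ P` orthogonally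
to the unit normal `u` at `p`, hence contains `P_u`. Near a point of `P_u` the two hypersurfaces
coincide (`eventually_form_eq_zero`), so `P_u` is open and closed in the connected set `P`, and
`P = P_u` (`IsTotallyGeodesicHyperplane.exists_eq_polar`).

For the last assertion, `P_u` separates `x` and `y` iff `⟨x, u⟩` and `⟨y, u⟩` have opposite signs
(`separates_polar_iff`). The measure of the set of these `u` depends only on `d(x, y)`, as two
reflections take a pair of points to any other pair at the same distance
(`exists_lorentz_apply_pair_eq`). It is finite, is positive at distance `1`, and is additive along a
geodesic, because the normals orthogonal to a given point form a null set (`muDS_sepNormals_add`).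
A nonnegative additive function of the distance is linear.
-/

noncomputable section

namespace HyperbolicWalls

/-! ### Coordinates on de Sitter space -/

theorem form_cons {n : ℕ} (a b : ℝ) (v w : Fin n → ℝ) :
    form (Fin.cons a v : E n) (Fin.cons b w) = -(a * b) + ∑ i, v i * w i := by
  simp [form]

theorem sum_sq_eq_of_mem_dS {n : ℕ} {u : E n} (hu : u ∈ dS n) :
    ∑ i : Fin n, u i.succ ^ 2 = 1 + u 0 ^ 2 := by
  have : form u u = 1 := hu
  simp only [form, ← pow_two] at this
  linarith


/-- The inverse of `param`: `u ↦ (arsinh u₀, (u₁, …, uₙ) / √(1 + u₀²))`. -/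
def paramInv (n : ℕ) (u : dS n) : ℝ × Sph n :=
  (Real.arsinh (u.1 0), ⟨WithLp.toLp 2 fun i => (Real.sqrt (1 + u.1 0 ^ 2))⁻¹ * u.1 i.succ, by
    have h0 : (0 : ℝ) < 1 + u.1 0 ^ 2 := by positivity
    rw [mem_sphere_zero_iff_norm, EuclideanSpace.norm_eq, Real.sqrt_eq_one]
    simp only [Real.norm_eq_abs, sq_abs, mul_pow, ← Finset.mul_sum, sum_sq_eq_of_mem_dS u.2,
      inv_pow, Real.sq_sqrt h0.le]
    exact inv_mul_cancel₀ h0.ne'⟩)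

/-- The parametrization `(r, θ) ↦ (sinh r, cosh r θ)` as a homeomorphism `ℝ × S^{n-1} ≃ₜ dSⁿ`. -/
def paramHomeomorph (n : ℕ) : ℝ × Sph n ≃ₜ dS n where
  toFun := param n
  invFun := paramInv n
  left_inv := by
    rintro ⟨r, θ⟩
    refine Prod.ext ?_ (Subtype.ext ?_)
    · simp [paramInv, param]
    · ext i
      have h : Real.sqrt (1 + Real.sinh r ^ 2) = Real.cosh r := by
        rw [add_comm, ← Real.cosh_sq, Real.sqrt_sq (Real.cosh_pos r).le]
      simp [paramInv, param, h, (Real.cosh_pos r).ne']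
  right_inv := by
    intro u
    refine Subtype.ext (funext fun i => ?_)
    refine Fin.cases ?_ (fun i => ?_) i
    · simp [paramInv, param]
    · have h0 : (0 : ℝ) < 1 + u.1 0 ^ 2 := by positivity
      simp [paramInv, param, Real.cosh_arsinh, (Real.sqrt_pos.2 h0).ne']
  continuous_toFun := by
    refine Continuous.subtype_mk (continuous_pi fun i => ?_) _
    refine Fin.cases ?_ (fun i => ?_) i
    · simp only [Fin.cons_zero]; fun_prop
    · simp only [Fin.cons_succ]; fun_prop
  continuous_invFun := by
    have hc (i) : Continuous fun u : dS n => u.1 i := (continuous_apply i).comp continuous_subtype_val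
    have hs : Continuous fun u : dS n => (Real.sqrt (1 + u.1 0 ^ 2))⁻¹ := by
      refine Continuous.inv₀ (((hc 0).pow 2).const_add 1).sqrt fun u => ?_
      have h0 : (0 : ℝ) < 1 + u.1 0 ^ 2 := by positivity
      exact (Real.sqrt_pos.2 h0).ne'
    refine Continuous.prodMk (Real.continuous_arsinh.comp (hc 0)) (Continuous.subtype_mk ?_ _)
    exact (PiLp.continuous_toLp 2 _).comp (continuous_pi fun i => hs.mul (hc i.succ))

theorem isHomeomorph_param (n : ℕ) : IsHomeomorph (param n) :=
  (paramHomeomorph n).isHomeomorph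

theorem measurable_param (n : ℕ) : Measurable (param n) :=
  (isHomeomorph_param n).continuous.measurable

/-! ### Truncated cones over subsets of de Sitter space -/

/-- The truncated cone `{t u | 0 < t < 1, u ∈ A}` over a set `A ⊆ dSⁿ`. -/
def truncCone {n : ℕ} (A : Set (dS n)) : Set (E n) :=
  (fun p : ℝ × E n => p.1 • p.2) '' (Ioo 0 1 ×ˢ (Subtype.val '' A))

theorem isClosed_dS (n : ℕ) : IsClosed (dS n) := by
  have : Continuous fun u : E n => form u u := continuous_form.comp (continuous_id.prodMk continuous_id)
  exact isClosed_eq this continuous_const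

/-- A ray from the origin meets `dSⁿ` at most once. -/
theorem injOn_smul_dS (n : ℕ) :
    InjOn (fun p : ℝ × E n => p.1 • p.2) (Ioi 0 ×ˢ dS n) := by
  rintro ⟨s, u⟩ ⟨hs, hu⟩ ⟨t, v⟩ ⟨ht, hv⟩ h
  simp only [mem_Ioi] at hs ht h
  have hu' : form u u = 1 := hu
  have hv' : form v v = 1 := hv
  have h1 : form (s • u) (s • u) = form (t • v) (t • v) := by rw [h]
  simp only [form_smul_left, form_smul_right, hu', hv', mul_one] at h1
  have hst : s = t := by
    have := (mul_self_eq_mul_self_iff).1 h1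
    rcases this with h | h <;> linarith
  subst hst
  exact Prod.ext rfl (smul_right_injective _ hs.ne' h)

theorem smul_mem_truncCone_iff {n : ℕ} {A : Set (dS n)} {t : ℝ} (ht : 0 < t) (u : dS n) :
    t • (u : E n) ∈ truncCone A ↔ t < 1 ∧ u ∈ A := by
  constructor
  · rintro ⟨⟨s, _⟩, ⟨hs, v, hv, rfl⟩, h⟩
    have := injOn_smul_dS n (show (s, v.1) ∈ Ioi (0 : ℝ) ×ˢ dS n from ⟨hs.1, v.2⟩)
      (show (t, u.1) ∈ Ioi (0 : ℝ) ×ˢ dS n from ⟨ht, u.2⟩) h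
    obtain ⟨rfl, h2⟩ := Prod.ext_iff.1 this
    obtain rfl := Subtype.ext h2
    exact ⟨hs.2, hv⟩
  · rintro ⟨h1, h2⟩
    exact ⟨(t, u), ⟨⟨ht, h1⟩, u, h2, rfl⟩, rfl⟩

theorem form_pos_of_mem_truncCone {n : ℕ} {A : Set (dS n)} {x : E n} (hx : x ∈ truncCone A) :
    0 < form x x := by
  obtain ⟨⟨t, _⟩, ⟨ht, u, -, rfl⟩, rfl⟩ := hx
  have hu : form u.1 u.1 = 1 := u.2
  simp only [form_smul_left, form_smul_right, hu]
  have := ht.1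
  positivity

theorem measurableSet_truncCone {n : ℕ} {A : Set (dS n)} (hA : MeasurableSet A) :
    MeasurableSet (truncCone A) := by
  refine MeasurableSet.image_of_continuousOn_injOn ?_ (by fun_prop) ?_
  · exact measurableSet_Ioo.prod
      ((MeasurableEmbedding.subtype_coe (isClosed_dS n).measurableSet).measurableSet_image.2 hA)
  · refine (injOn_smul_dS n).mono (prod_mono (fun t ht => ht.1) ?_)
    rintro _ ⟨u, -, rfl⟩
    exact u.2

/-! ### Integration in polar coordinates -/

/-- Integration in spherical coordinates `x = ρ θ`. -/
theorem lintegral_eq_lintegral_toSphere {F : Type*} [NormedAddCommGroup F] [NormedSpace ℝ F]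
    [FiniteDimensional ℝ F] [Nontrivial F] [MeasurableSpace F] [BorelSpace F] (μ : Measure F)
    [μ.IsAddHaarMeasure] {f : F → ℝ≥0∞} (hf : Measurable f) :
    ∫⁻ x, f x ∂μ = ∫⁻ θ, (∫⁻ ρ in Ioi (0 : ℝ),
      ENNReal.ofReal (ρ ^ (Module.finrank ℝ F - 1)) * f (ρ • θ.1)) ∂μ.toSphere := by
  have hm : Measurable fun p : Metric.sphere (0 : F) 1 × Ioi (0 : ℝ) => f (p.2.1 • p.1.1) :=
    hf.comp (by fun_prop)
  calc ∫⁻ x, f x ∂μ = ∫⁻ x : ({0}ᶜ : Set F), f x ∂(μ.comap Subtype.val) := by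
        rw [lintegral_subtype_comap (measurableSet_singleton _).compl, restrict_compl_singleton]
    _ = ∫⁻ p, f (p.2.1 • p.1.1) ∂(μ.toSphere.prod (.volumeIoiPow (Module.finrank ℝ F - 1))) := by
        rw [← μ.measurePreserving_homeomorphUnitSphereProd.lintegral_comp hm]
        refine lintegral_congr fun x => ?_
        congr 1
        have hx : ‖x.1‖ ≠ 0 := norm_ne_zero_iff.2 x.2
        simp [smul_smul, hx]
    _ = _ := by
        rw [lintegral_prod _ hm.aemeasurable]
        refine lintegral_congr fun θ => ?_
        have h1 : Measurable fun ρ : Ioi (0 : ℝ) => f (ρ.1 • θ.1) := hf.comp (by fun_prop)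
        rw [Measure.volumeIoiPow, lintegral_withDensity_eq_lintegral_mul _ (by fun_prop) h1]
        simp only [Pi.mul_apply]
        exact lintegral_subtype_comap measurableSet_Ioi
          (fun ρ : ℝ => ENNReal.ofReal (ρ ^ (Module.finrank ℝ F - 1)) * f (ρ • θ.1))

/-- The derivative of `(t, r) ↦ (t sinh r, t cosh r)`. -/
def fderivHypPolar (q : ℝ × ℝ) : ℝ × ℝ →L[ℝ] ℝ × ℝ :=
  LinearMap.toContinuousLinearMap (Matrix.toLin (Module.Basis.finTwoProd ℝ)
    (Module.Basis.finTwoProd ℝ)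
    !![Real.sinh q.2, q.1 * Real.cosh q.2; Real.cosh q.2, q.1 * Real.sinh q.2])

theorem hasFDerivAt_hypPolar (q : ℝ × ℝ) :
    HasFDerivAt (fun q : ℝ × ℝ => (q.1 * Real.sinh q.2, q.1 * Real.cosh q.2))
      (fderivHypPolar q) q := by
  unfold fderivHypPolar
  rw [Matrix.toLin_finTwoProd_toContinuousLinearMap]
  convert! HasFDerivAt.prodMk (𝕜 := ℝ)
    (hasFDerivAt_fst.mul ((Real.hasDerivAt_sinh q.2).comp_hasFDerivAt q hasFDerivAt_snd))
    (hasFDerivAt_fst.mul ((Real.hasDerivAt_cosh q.2).comp_hasFDerivAt q hasFDerivAt_snd))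
    using 2 <;>
  simp [smul_smul, add_comm]

theorem det_fderivHypPolar (q : ℝ × ℝ) : (fderivHypPolar q).det = -q.1 := by
  unfold fderivHypPolar
  simp only [LinearMap.det_toContinuousLinearMap, LinearMap.det_toLin, Matrix.det_fin_two_of]
  linear_combination (-q.1) * Real.cosh_sq q.2

theorem injOn_hypPolar :
    InjOn (fun q : ℝ × ℝ => (q.1 * Real.sinh q.2, q.1 * Real.cosh q.2)) (Ioi 0 ×ˢ univ) := by
  rintro ⟨t, r⟩ ⟨ht, -⟩ ⟨s, v⟩ ⟨hs, -⟩ h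
  simp only [mem_Ioi, Prod.mk.injEq] at ht hs h
  obtain ⟨h1, h2⟩ := h
  have h3 : t ^ 2 = s ^ 2 := by
    have e : ∀ a b : ℝ, (a * Real.cosh b) ^ 2 - (a * Real.sinh b) ^ 2 = a ^ 2 := fun a b => by
      nlinarith [Real.cosh_sq b]
    rw [← e t r, ← e s v, h1, h2]
  obtain rfl : t = s := (sq_eq_sq₀ ht.le hs.le).1 h3
  rw [Real.sinh_injective (mul_left_cancel₀ ht.ne' h1)]

theorem image_hypPolar :
    (fun q : ℝ × ℝ => (q.1 * Real.sinh q.2, q.1 * Real.cosh q.2)) '' (Ioi 0 ×ˢ univ) =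
      {p | |p.1| < p.2} := by
  ext ⟨a, b⟩
  simp only [mem_image, mem_prod, mem_Ioi, mem_univ, and_true, Prod.exists, Prod.mk.injEq,
    mem_ofPred_eq]
  constructor
  · rintro ⟨t, r, ht, rfl, rfl⟩
    rw [abs_mul, abs_of_pos ht]
    refine mul_lt_mul_of_pos_left (abs_lt_of_sq_lt_sq ?_ (Real.cosh_pos r).le) ht
    rw [Real.cosh_sq]; linarith
  · intro h
    have hb : 0 < b := (abs_nonneg a).trans_lt h
    have hab : 0 < b ^ 2 - a ^ 2 := by
      have := sq_lt_sq.2 (h.trans_le (le_abs_self b)); linarith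
    have hs := Real.sqrt_pos.2 hab
    have h1 : Real.sqrt (1 + (a / Real.sqrt (b ^ 2 - a ^ 2)) ^ 2) = b / Real.sqrt (b ^ 2 - a ^ 2) := by
      rw [Real.sqrt_eq_iff_mul_self_eq (by positivity) (by positivity), div_pow,
        Real.sq_sqrt hab.le, ← pow_two, div_pow, Real.sq_sqrt hab.le]
      field_simp; ring
    refine ⟨Real.sqrt (b ^ 2 - a ^ 2), Real.arsinh (a / Real.sqrt (b ^ 2 - a ^ 2)), hs, ?_, ?_⟩
    · rw [Real.sinh_arsinh]; field_simp
    · rw [Real.cosh_arsinh, h1]; field_simp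

/-- Integration over the planar sector `|a| < b` in the coordinates `(t sinh r, t cosh r)`. -/
theorem lintegral_hypPolar (g : ℝ × ℝ → ℝ≥0∞) :
    ∫⁻ p in {p : ℝ × ℝ | |p.1| < p.2}, g p =
      ∫⁻ q in Ioi (0 : ℝ) ×ˢ univ,
        ENNReal.ofReal q.1 * g (q.1 * Real.sinh q.2, q.1 * Real.cosh q.2) := by
  have hm : MeasurableSet (Ioi (0 : ℝ) ×ˢ (univ : Set ℝ)) := measurableSet_Ioi.prod .univ
  rw [← image_hypPolar, lintegral_image_eq_lintegral_abs_det_fderiv_mul volume hm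
    (fun q _ => (hasFDerivAt_hypPolar q).hasFDerivWithinAt) injOn_hypPolar]
  refine setLIntegral_congr_fun hm fun q hq => ?_
  simp only [det_fderivHypPolar, abs_neg, abs_of_pos (show 0 < q.1 from hq.1)]

/-! ### The measure on de Sitter space as a cone measure -/

theorem lintegral_E {n : ℕ} (f : E n → ℝ≥0∞) :
    ∫⁻ x, f x = ∫⁻ p : ℝ × (Fin n → ℝ), f (Fin.cons p.1 p.2) := by
  have h := (volume_preserving_piFinSuccAbove (fun _ : Fin (n + 1) => ℝ) 0).symm
  rw [← h.lintegral_comp_emb (MeasurableEquiv.measurableEmbedding _)]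
  refine lintegral_congr fun p => ?_
  congr 1
  simp [MeasurableEquiv.piFinSuccAbove, Fin.insertNthEquiv]

theorem lintegral_pow_Ioo (n : ℕ) :
    ∫⁻ t in Ioo (0 : ℝ) 1, ENNReal.ofReal (t ^ n) = ENNReal.ofReal ((n + 1 : ℝ)⁻¹) := by
  rw [Measure.restrict_congr_set Ioo_ae_eq_Ioc,
    ← ofReal_integral_eq_lintegral_ofReal
      (intervalIntegral.intervalIntegrable_pow n (μ := volume) (a := 0) (b := 1)).1,
    ← intervalIntegral.integral_of_le zero_le_one]
  · simp
  · filter_upwards [ae_restrict_mem measurableSet_Ioc] with y hy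
    exact pow_nonneg hy.1.le _

theorem add_one_mul_ofReal_inv (n : ℕ) :
    (n + 1 : ℝ≥0∞) * ENNReal.ofReal ((n + 1 : ℝ)⁻¹) = 1 := by
  have : (n + 1 : ℝ≥0∞) = ENNReal.ofReal (n + 1) := by
    rw [ENNReal.ofReal_add (by positivity) zero_le_one]; simp
  rw [this, ← ENNReal.ofReal_mul (by positivity), mul_inv_cancel₀ (by positivity),
    ENNReal.ofReal_one]

theorem muDS_apply_param {n : ℕ} {A : Set (dS n)} (hA : MeasurableSet A) :
    muDS n A = ∫⁻ θ, (∫⁻ r : ℝ, ENNReal.ofReal (Real.cosh r ^ (n - 1)) *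
      A.indicator 1 (param n (r, θ))) ∂(volume : Measure (EuclideanSpace ℝ (Fin n))).toSphere := by
  have hA' := measurable_param n hA
  have hm : Measurable fun z : ℝ × Sph n =>
      ENNReal.ofReal (Real.cosh z.1 ^ (n - 1)) * A.indicator 1 (param n z) :=
    Measurable.mul (by fun_prop) ((measurable_one.indicator hA).comp (measurable_param n))
  rw [muDS, Measure.map_apply (measurable_param n) hA, withDensity_apply _ hA',
    ← lintegral_indicator hA', ← lintegral_prod_symm' _ hm]
  refine lintegral_congr fun z => ?_
  by_cases hz : param n z ∈ A <;> simp [hz, indicator]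

theorem param_smul {n : ℕ} (t r : ℝ) (θ : Sph n) :
    t • (param n (r, θ) : E n) =
      Fin.cons (t * Real.sinh r) fun i => t * Real.cosh r * θ.1 i := by
  ext i
  refine Fin.cases ?_ (fun i => ?_) i
  · simp [param]
  · simp [param, mul_assoc]

/-- The measure `cosh^{n-1} r dr dθ` of a subset of `dSⁿ` is `n + 1` times the Lebesgue measure of
the truncated cone over it. -/
theorem muDS_apply {n : ℕ} (hn : 1 ≤ n) {A : Set (dS n)} (hA : MeasurableSet A) :
    muDS n A = (n + 1 : ℝ≥0∞) * volume (truncCone A) := by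
  have : Nonempty (Fin n) := ⟨⟨0, hn⟩⟩
  have hC := measurableSet_truncCone hA
  set I : E n → ℝ≥0∞ := (truncCone A).indicator 1 with hI
  have hIm : Measurable I := measurable_one.indicator hC
  let σ := (volume : Measure (EuclideanSpace ℝ (Fin n))).toSphere
  have hcons : Measurable fun p : ℝ × (Fin n → ℝ) => (Fin.cons p.1 p.2 : E n) := by
    refine measurable_pi_lambda _ fun i => ?_
    refine Fin.cases ?_ (fun i => ?_) i
    · simp only [Fin.cons_zero]; fun_prop
    · simp only [Fin.cons_succ]; fun_prop
  -- the integrand in spherical coordinates of `ℝⁿ`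
  let J : (ℝ × ℝ) → Sph n → ℝ≥0∞ := fun p θ =>
    ENNReal.ofReal (p.2 ^ (n - 1)) * I (Fin.cons p.1 fun i => p.2 * θ.1 i)
  have hJ : Measurable fun q : (ℝ × ℝ) × Sph n => J q.1 q.2 := by
    refine Measurable.mul (by fun_prop) (hIm.comp (hcons.comp (f := fun q : (ℝ × ℝ) × Sph n =>
      (q.1.1, fun i => q.1.2 * q.2.1 i)) (by fun_prop)))
  have h1 : volume (truncCone A) = ∫⁻ a : ℝ, ∫⁻ θ, (∫⁻ ρ in Ioi (0 : ℝ), J (a, ρ) θ) ∂σ := by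
    rw [← lintegral_indicator_one hC, lintegral_E, Measure.volume_eq_prod,
      lintegral_prod (fun p : ℝ × (Fin n → ℝ) => I (Fin.cons p.1 p.2))
        (hIm.comp hcons).aemeasurable]
    refine lintegral_congr fun a => ?_
    have hm : Measurable fun v : EuclideanSpace ℝ (Fin n) => I (Fin.cons a v.ofLp) :=
      hIm.comp (hcons.comp (f := fun v : EuclideanSpace ℝ (Fin n) => (a, v.ofLp)) (by fun_prop))
    rw [← (PiLp.volume_preserving_ofLp (Fin n)).lintegral_comp_emb
      (MeasurableEquiv.toLp 2 (Fin n → ℝ)).symm.measurableEmbedding,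
      lintegral_eq_lintegral_toSphere volume hm]
    simp only [finrank_euclideanSpace, Fintype.card_fin]
    rfl
  have h2 : ∀ θ, ∫⁻ a : ℝ, (∫⁻ ρ in Ioi (0 : ℝ), J (a, ρ) θ) =
      ENNReal.ofReal ((n + 1 : ℝ)⁻¹) *
        ∫⁻ r : ℝ, ENNReal.ofReal (Real.cosh r ^ (n - 1)) * A.indicator 1 (param n (r, θ)) := by
    intro θ
    have hJθ : Measurable fun p : ℝ × ℝ => J p θ :=
      hJ.comp (f := fun p : ℝ × ℝ => (p, θ)) (by fun_prop)
    have hsub : {p : ℝ × ℝ | |p.1| < p.2} ⊆ univ ×ˢ Ioi 0 :=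
      fun p hp => ⟨trivial, (abs_nonneg p.1).trans_lt hp⟩
    have hop : IsOpen {p : ℝ × ℝ | |p.1| < p.2} := isOpen_lt (by fun_prop) (by fun_prop)
    have hm : Measurable fun r : ℝ => ENNReal.ofReal (Real.cosh r ^ (n - 1)) *
        A.indicator (1 : dS n → ℝ≥0∞) (param n (r, θ)) :=
      Measurable.mul (by fun_prop) ((measurable_one.indicator hA).comp
        ((measurable_param n).comp (by fun_prop)))
    calc ∫⁻ a : ℝ, (∫⁻ ρ in Ioi (0 : ℝ), J (a, ρ) θ)
        = ∫⁻ p in (univ : Set ℝ) ×ˢ Ioi (0 : ℝ), J p θ := by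
          rw [Measure.volume_eq_prod, setLIntegral_prod _ hJθ.aemeasurable, Measure.restrict_univ]
      _ = ∫⁻ p in {p : ℝ × ℝ | |p.1| < p.2}, J p θ := by
          -- the cone is contained in the spacelike region `|a| < ρ`
          rw [← lintegral_indicator (MeasurableSet.univ.prod measurableSet_Ioi),
            ← lintegral_indicator hop.measurableSet]
          refine lintegral_congr fun p => ?_
          by_cases hp2 : |p.1| < p.2
          · rw [indicator_of_mem (hsub hp2), indicator_of_mem (show p ∈ {p : ℝ × ℝ | |p.1| < p.2} from hp2)]
          rw [indicator_of_notMem (show p ∉ {p : ℝ × ℝ | |p.1| < p.2} from hp2)]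
          refine indicator_apply_eq_zero.2 fun hp => ?_
          have : (Fin.cons p.1 fun i => p.2 * θ.1 i : E n) ∉ truncCone A := by
            intro hmem
            have h3 := form_pos_of_mem_truncCone hmem
            have h4 : ∑ i, p.2 * θ.1 i * (p.2 * θ.1 i) = p.2 ^ 2 := by
              have h5 := EuclideanSpace.norm_sq_eq θ.1
              rw [mem_sphere_zero_iff_norm.1 θ.2] at h5
              simp only [Real.norm_eq_abs, sq_abs, one_pow] at h5
              calc _ = p.2 ^ 2 * ∑ i, (θ.1 i) ^ 2 := by
                    rw [Finset.mul_sum]; exact Finset.sum_congr rfl fun i _ => by ring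
                _ = _ := by rw [← h5, mul_one]
            rw [form_cons, h4] at h3
            exact hp2 (abs_lt_of_sq_lt_sq (by nlinarith) (le_of_lt hp.2))
          simp [J, hI, this]
      _ = ∫⁻ q in Ioi (0 : ℝ) ×ˢ univ,
            ENNReal.ofReal q.1 * J (q.1 * Real.sinh q.2, q.1 * Real.cosh q.2) θ :=
          lintegral_hypPolar _
      _ = ∫⁻ q in Ioi (0 : ℝ) ×ˢ univ, (Iio 1).indicator (fun t => ENNReal.ofReal (t ^ n)) q.1 *
            (ENNReal.ofReal (Real.cosh q.2 ^ (n - 1)) * A.indicator 1 (param n (q.2, θ))) := by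
          refine setLIntegral_congr_fun (measurableSet_Ioi.prod .univ) fun q hq => ?_
          have ht : 0 < q.1 := hq.1
          simp only [J, ← param_smul, hI]
          by_cases h1 : q.1 < 1
          · by_cases h2 : param n (q.2, θ) ∈ A
            · rw [indicator_of_mem ((smul_mem_truncCone_iff ht _).2 ⟨h1, h2⟩),
                indicator_of_mem (show q.1 ∈ Iio 1 from h1), indicator_of_mem h2]
              simp only [Pi.one_apply, mul_one]
              rw [mul_pow, ← ENNReal.ofReal_mul ht.le, ← ENNReal.ofReal_mul (by positivity),
                ← mul_assoc, mul_pow_sub_one (by omega)]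
            · rw [indicator_of_notMem (fun h => h2 ((smul_mem_truncCone_iff ht _).1 h).2),
                indicator_of_notMem h2]
              simp
          · rw [indicator_of_notMem (fun h => h1 ((smul_mem_truncCone_iff ht _).1 h).1),
              indicator_of_notMem (show q.1 ∉ Iio 1 from h1)]
            simp
      _ = _ := by
          rw [Measure.volume_eq_prod, ← Measure.prod_restrict, Measure.restrict_univ,
            lintegral_prod_mul (by
              exact (Measurable.indicator (by fun_prop) measurableSet_Iio).aemeasurable)
              hm.aemeasurable,
            lintegral_indicator measurableSet_Iio, Measure.restrict_restrict measurableSet_Iio,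
            inter_comm, Ioi_inter_Iio, lintegral_pow_Ioo]
  have h3 : ∀ a : ℝ, Measurable fun q : Sph n × ℝ => J (a, q.2) q.1 := fun a =>
    hJ.comp (f := fun q : Sph n × ℝ => ((a, q.2), q.1)) (by fun_prop)
  have hmeas : Measurable fun p : ℝ × Sph n => ∫⁻ ρ in Ioi (0 : ℝ), J (p.1, ρ) p.2 :=
    Measurable.lintegral_prod_right' (f := fun q : (ℝ × Sph n) × ℝ => J (q.1.1, q.2) q.1.2)
      (hJ.comp (f := fun q : (ℝ × Sph n) × ℝ => ((q.1.1, q.2), q.1.2)) (by fun_prop))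
  rw [h1, lintegral_lintegral_swap hmeas.aemeasurable]
  simp only [h2]
  rw [lintegral_const_mul' _ _ ENNReal.ofReal_ne_top, ← mul_assoc, add_one_mul_ofReal_inv, one_mul,
    muDS_apply_param hA]

/-! ### The volume measure of the Lorentzian metric -/

/-- The Gram determinant of the images of the standard basis under `L` is `-(det L)²`. -/
theorem det_gram {n : ℕ} (L : E n →ₗ[ℝ] E n) :
    Matrix.det (Matrix.of fun i j => form (L (Pi.single i 1)) (L (Pi.single j 1))) =
      -(LinearMap.det L) ^ 2 := by
  set M := LinearMap.toMatrix' L with hM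
  let J : Matrix (Fin (n + 1)) (Fin (n + 1)) ℝ := Matrix.diagonal (Fin.cons (-1) fun _ => 1)
  have h : (Matrix.of fun i j => form (L (Pi.single i 1)) (L (Pi.single j 1))) =
      M.transpose * J * M := by
    ext i j
    have hM' : ∀ k l, M k l = L (Pi.single l 1) k := fun k l => LinearMap.toMatrix'_apply L k l
    rw [Matrix.mul_apply, Fin.sum_univ_succ]
    simp only [J, Matrix.mul_diagonal, Matrix.transpose_apply, Matrix.of_apply, hM', form,
      Fin.cons_zero, Fin.cons_succ]
    simp
  rw [h, Matrix.det_mul, Matrix.det_mul, Matrix.det_transpose, Matrix.det_diagonal,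
    Fin.prod_univ_succ, hM, LinearMap.det_toMatrix']
  simp
  ring

theorem hasFDerivAt_smul_tail {n : ℕ} {φ : (Fin n → ℝ) → E n} {z : E n}
    (h : DifferentiableAt ℝ φ (Fin.tail z)) :
    HasFDerivAt (fun z : E n => z 0 • φ (Fin.tail z))
      (z 0 • (fderiv ℝ φ (Fin.tail z)).comp
          (ContinuousLinearMap.pi fun i : Fin n => ContinuousLinearMap.proj i.succ) +
        (ContinuousLinearMap.proj 0 : E n →L[ℝ] ℝ).smulRight (φ (Fin.tail z))) z := by
  have ht : HasFDerivAt (fun z : E n => (Fin.tail z : Fin n → ℝ))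
      (ContinuousLinearMap.pi fun i : Fin n => ContinuousLinearMap.proj i.succ) z :=
    (ContinuousLinearMap.pi fun i : Fin n =>
      (ContinuousLinearMap.proj i.succ : E n →L[ℝ] ℝ)).hasFDerivAt
  exact (ContinuousLinearMap.proj 0 : E n →L[ℝ] ℝ).hasFDerivAt.smul (h.hasFDerivAt.comp z ht)

/-- In the cone coordinates `(t, x) ↦ t φ(x)` over a chart `φ` of `dSⁿ` the Jacobian determinant is
`tⁿ √|det g|`: the vector `φ(x)` has square `1` and is orthogonal to the `∂ᵢφ`, hence the Gram matrix
of the partial derivatives is block diagonal with blocks `1` and `t² g`. -/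
theorem abs_det_smul_tail {n : ℕ} {φ : (Fin n → ℝ) → E n} {t : ℝ} (ht : 0 ≤ t) {x : Fin n → ℝ}
    (h1 : form (φ x) (φ x) = 1) (h2 : ∀ v, form (φ x) (fderiv ℝ φ x v) = 0) :
    |(t • (fderiv ℝ φ x).comp
          (ContinuousLinearMap.pi fun i : Fin n => (ContinuousLinearMap.proj i.succ : E n →L[ℝ] ℝ)) +
        (ContinuousLinearMap.proj 0 : E n →L[ℝ] ℝ).smulRight (φ x)).det| =
      t ^ n * Real.sqrt |Matrix.det (Matrix.of fun i j : Fin n =>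
        form (fderiv ℝ φ x (Pi.single i 1)) (fderiv ℝ φ x (Pi.single j 1)))| := by
  set L : E n →L[ℝ] E n := t • (fderiv ℝ φ x).comp
          (ContinuousLinearMap.pi fun i : Fin n => (ContinuousLinearMap.proj i.succ : E n →L[ℝ] ℝ)) +
        (ContinuousLinearMap.proj 0 : E n →L[ℝ] ℝ).smulRight (φ x) with hL
  set g : Matrix (Fin n) (Fin n) ℝ := Matrix.of fun i j : Fin n =>
        form (fderiv ℝ φ x (Pi.single i 1)) (fderiv ℝ φ x (Pi.single j 1)) with hg
  have e0 : L (Pi.single 0 1) = φ x := by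
    have : (fun _ : Fin n => (0 : ℝ)) = 0 := rfl
    simp [hL, ContinuousLinearMap.coe_pi', this]
  have es : ∀ i : Fin n, L (Pi.single i.succ 1) = t • fderiv ℝ φ x (Pi.single i 1) := by
    intro i
    have : (fun j : Fin n => (Pi.single i.succ 1 : E n) j.succ) = Pi.single i 1 := by
      ext j; simp [Pi.single_apply]
    simp [hL, ContinuousLinearMap.coe_pi', this]
  have hdet : Matrix.det (Matrix.of fun i j => form (L (Pi.single i 1)) (L (Pi.single j 1))) =
      (t ^ n) ^ 2 * g.det := by
    rw [Matrix.det_succ_row_zero, Fin.sum_univ_succ]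
    have : Matrix.submatrix (Matrix.of fun i j => form (L (Pi.single i 1)) (L (Pi.single j 1)))
        Fin.succ Fin.succ = (t ^ 2) • g := by
      ext i j
      simp [es, form_smul_left, form_smul_right, hg]
      ring
    simp [this, e0, es, h1, h2, form_smul_right, ← pow_mul, mul_comm]
  have h3 := det_gram (L : E n →ₗ[ℝ] E n)
  simp only [ContinuousLinearMap.coe_coe] at h3
  rw [hdet] at h3
  have h4 : |g.det| * (t ^ n) ^ 2 = L.det ^ 2 := by
    rw [ContinuousLinearMap.det, ← abs_of_nonneg (sq_nonneg (LinearMap.det (L : E n →ₗ[ℝ] E n))),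
      ← abs_neg (_ ^ 2), ← h3, abs_mul, abs_of_nonneg (sq_nonneg (t ^ n)), mul_comm]
  rw [← Real.sqrt_sq_eq_abs, ← h4, Real.sqrt_mul (abs_nonneg _), Real.sqrt_sq (by positivity),
    mul_comm]

theorem isVolumeMeasure_muDS {n : ℕ} (hn : 1 ≤ n) : IsVolumeMeasure (muDS n) := by
  intro U φ hU hφ hinj hmaps
  have hd : ∀ x ∈ U, DifferentiableAt ℝ φ x := fun x hx =>
    (hφ.differentiableOn one_ne_zero).differentiableAt (hU.mem_nhds hx)
  -- differentiate `⟨φ, φ⟩ = 1`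
  have horth : ∀ x ∈ U, ∀ v, form (φ x) (fderiv ℝ φ x v) = 0 := by
    intro x hx v
    have h1 : HasFDerivAt (fun y => form (φ y) (φ y)) (0 : (Fin n → ℝ) →L[ℝ] ℝ) x := by
      refine (hasFDerivAt_const (1 : ℝ) x).congr_of_eventuallyEq ?_
      filter_upwards [hU.mem_nhds hx] with y hy using hmaps hy
    have hc (i) : HasFDerivAt (fun y => φ y i)
        ((ContinuousLinearMap.proj i : E n →L[ℝ] ℝ).comp (fderiv ℝ φ x)) x :=
      (ContinuousLinearMap.proj i : E n →L[ℝ] ℝ).hasFDerivAt.comp x (hd x hx).hasFDerivAt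
    have h2 := ((hc 0).mul (hc 0)).neg.add
      (HasFDerivAt.fun_sum (u := Finset.univ) fun i : Fin n => fun _ => (hc i.succ).mul (hc i.succ))
    have h3 := congrArg (fun l => l v) (h2.unique h1)
    simp [← two_mul, ← Finset.mul_sum] at h3
    simp only [form]
    linarith
  set G : (Fin n → ℝ) → ℝ := fun x => Real.sqrt |Matrix.det (Matrix.of fun i j : Fin n =>
        form (fderiv ℝ φ x (Pi.single i 1)) (fderiv ℝ φ x (Pi.single j 1)))| with hG
  have hGc : ContinuousOn G U := by
    have h1 : ContinuousOn (fderiv ℝ φ) U := hφ.continuousOn_fderiv_of_isOpen hU le_rfl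
    refine Real.continuous_sqrt.comp_continuousOn (continuous_abs.comp_continuousOn ?_)
    have h2 : Continuous fun l : (Fin n → ℝ) →L[ℝ] E n => Matrix.det (Matrix.of fun i j : Fin n =>
        form (l (Pi.single i 1)) (l (Pi.single j 1))) := by
      refine Continuous.matrix_det (continuous_matrix fun i j => ?_)
      exact continuous_form.comp (f := fun l : (Fin n → ℝ) →L[ℝ] E n =>
        (l (Pi.single i 1), l (Pi.single j 1))) (by fun_prop)
    exact h2.comp_continuousOn h1
  have himg : MeasurableSet (φ '' U) :=
    hU.measurableSet.image_of_continuousOn_injOn hφ.continuousOn hinj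
  have hA : MeasurableSet {u : dS n | (u : E n) ∈ φ '' U} := measurable_subtype_coe himg
  let s : Set (E n) := {z | z 0 ∈ Ioo (0 : ℝ) 1 ∧ (Fin.tail z : Fin n → ℝ) ∈ U}
  have htail : Continuous fun z : E n => (Fin.tail z : Fin n → ℝ) :=
    continuous_pi fun i => continuous_apply i.succ
  have hs : MeasurableSet s :=
    ((isOpen_Ioo.preimage (continuous_apply 0)).inter (hU.preimage htail)).measurableSet
  have hcone : truncCone {u : dS n | (u : E n) ∈ φ '' U} =
      (fun z : E n => z 0 • φ (Fin.tail z)) '' s := by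
    ext y
    constructor
    · rintro ⟨⟨t, _⟩, ⟨ht, u, ⟨x, hx, hxu⟩, rfl⟩, rfl⟩
      exact ⟨Fin.cons t x, ⟨by simpa using ht, by simpa using hx⟩, by simp [hxu]⟩
    · rintro ⟨z, ⟨h0, h1⟩, rfl⟩
      exact ⟨(z 0, φ (Fin.tail z)), ⟨h0, ⟨⟨_, hmaps h1⟩, ⟨_, h1, rfl⟩, rfl⟩⟩, rfl⟩
  have hinjs : InjOn (fun z : E n => z 0 • φ (Fin.tail z)) s := by
    intro z hz w hw h
    have := injOn_smul_dS n (show (z 0, φ (Fin.tail z)) ∈ Ioi (0 : ℝ) ×ˢ dS n from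
      ⟨hz.1.1, hmaps hz.2⟩) (show (w 0, φ (Fin.tail w)) ∈ Ioi (0 : ℝ) ×ˢ dS n from
      ⟨hw.1.1, hmaps hw.2⟩) h
    obtain ⟨h0, h1⟩ := Prod.ext_iff.1 this
    have h2 := hinj hz.2 hw.2 h1
    rw [← Fin.cons_self_tail z, ← Fin.cons_self_tail w, h2, show z 0 = w 0 from h0]
  have hprod : MeasurableSet (Ioo (0 : ℝ) 1 ×ˢ U) := measurableSet_Ioo.prod hU.measurableSet
  rw [muDS_apply hn hA, hcone, ← lintegral_abs_det_fderiv_eq_addHaar_image volume hs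
    (fun z hz => (hasFDerivAt_smul_tail (hd _ hz.2)).hasFDerivWithinAt) hinjs]
  have h1 : ∀ z ∈ s, ENNReal.ofReal |(z 0 • (fderiv ℝ φ (Fin.tail z)).comp
          (ContinuousLinearMap.pi fun i : Fin n => (ContinuousLinearMap.proj i.succ : E n →L[ℝ] ℝ)) +
        (ContinuousLinearMap.proj 0 : E n →L[ℝ] ℝ).smulRight (φ (Fin.tail z))).det| =
      ENNReal.ofReal (z 0 ^ n) * ENNReal.ofReal (G (Fin.tail z)) := by
    intro z hz
    rw [abs_det_smul_tail hz.1.1.le (hmaps hz.2) (horth _ hz.2),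
      ENNReal.ofReal_mul (pow_nonneg hz.1.1.le _)]
  rw [setLIntegral_congr_fun hs h1, ← lintegral_indicator hs, lintegral_E]
  have h2 : ∀ p : ℝ × (Fin n → ℝ), s.indicator (fun z : E n => ENNReal.ofReal (z 0 ^ n) *
      ENNReal.ofReal (G (Fin.tail z))) (Fin.cons p.1 p.2) = (Ioo (0 : ℝ) 1 ×ˢ U).indicator
        (fun p => ENNReal.ofReal (p.1 ^ n) * ENNReal.ofReal (G p.2)) p := by
    intro p
    by_cases hp : p ∈ Ioo (0 : ℝ) 1 ×ˢ U
    · rw [indicator_of_mem hp, indicator_of_mem (by simpa [s] using hp)]; simp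
    · rw [indicator_of_notMem hp, indicator_of_notMem (by simpa [s] using hp)]
  simp only [h2]
  rw [lintegral_indicator hprod, Measure.volume_eq_prod, ← Measure.prod_restrict,
    lintegral_prod_mul (f := fun t : ℝ => ENNReal.ofReal (t ^ n)) (by fun_prop)
      (hGc.aemeasurable hU.measurableSet).ennreal_ofReal,
    lintegral_pow_Ioo, ← mul_assoc, add_one_mul_ofReal_inv, one_mul]

/-! ### Invariance under the Lorentz group -/

theorem abs_det_of_mem_lorentzGroup {n : ℕ} (g : lorentzGroup n) :
    |LinearMap.det (g.1 : E n →ₗ[ℝ] E n)| = 1 := by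
  have h1 := det_gram (g.1 : E n →ₗ[ℝ] E n)
  have h2 := det_gram (LinearMap.id : E n →ₗ[ℝ] E n)
  simp only [LinearEquiv.coe_coe, LinearMap.id_apply, LinearMap.det_id] at h1 h2
  simp only [g.2 _ _, h2] at h1
  rw [← sq_eq_sq₀ (abs_nonneg _) zero_le_one, sq_abs]
  linarith

theorem measurable_actDS {n : ℕ} (g : lorentzGroup n) : Measurable (actDS g) :=
  (Continuous.subtype_mk ((LinearMap.continuous_of_finiteDimensional (g.1 : E n →ₗ[ℝ] E n)).comp
    continuous_subtype_val) _).measurable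

theorem truncCone_preimage_actDS {n : ℕ} (g : lorentzGroup n) (A : Set (dS n)) :
    truncCone (actDS g ⁻¹' A) = g.1 ⁻¹' truncCone A := by
  ext x
  constructor
  · rintro ⟨⟨t, _⟩, ⟨ht, u, hu, rfl⟩, rfl⟩
    exact ⟨(t, actDS g u), ⟨ht, _, hu, rfl⟩, by simp [actDS]⟩
  · rintro ⟨⟨t, _⟩, ⟨ht, u, hu, rfl⟩, h⟩
    have hgg : actDS g (actDS g⁻¹ u) = u :=
      Subtype.ext (g.1.apply_symm_apply u.1)
    refine ⟨(t, actDS g⁻¹ u), ⟨ht, _, ?_, rfl⟩, ?_⟩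
    · rwa [mem_preimage, hgg]
    · apply g.1.injective
      rw [← h]
      simp only [map_smul]
      congr 1
      exact congrArg Subtype.val hgg

theorem measurePreserving_actDS {n : ℕ} (hn : 1 ≤ n) (g : lorentzGroup n) :
    MeasurePreserving (actDS g) (muDS n) (muDS n) := by
  refine ⟨measurable_actDS g, Measure.ext fun A hA => ?_⟩
  rw [Measure.map_apply (measurable_actDS g) hA, muDS_apply hn hA,
    muDS_apply hn (measurable_actDS g hA), truncCone_preimage_actDS]
  have hdet := abs_det_of_mem_lorentzGroup g
  have h0 : LinearMap.det (g.1 : E n →ₗ[ℝ] E n) ≠ 0 := fun h => by simp [h] at hdet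
  have := Measure.addHaar_preimage_linearMap volume h0 (truncCone A)
  rw [abs_inv, hdet, inv_one, ENNReal.ofReal_one, one_mul] at this
  exact congrArg _ this

/-! ### Lorentzian geometry -/

/-- A unit timelike vector lies on the upper sheet as soon as it has negative product with one point
of the upper sheet. -/
theorem mem_hyp_of_form_neg {n : ℕ} {x z : E n} (hx : x ∈ Hyp n) (hz : form z z = -1)
    (h : form x z < 0) : z ∈ Hyp n := by
  refine ⟨hz, ?_⟩
  by_contra hneg
  have hne : z 0 ≠ 0 := by
    intro h0
    have : (0 : ℝ) ≤ form z z := by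
      simp only [form, h0, mul_zero, neg_zero, zero_add]
      exact Finset.sum_nonneg fun i _ => mul_self_nonneg _
    linarith
  have hmem : (-1 : ℝ) • z ∈ Hyp n := by
    refine ⟨by rw [form_smul_left, form_smul_right, hz]; ring, ?_⟩
    simp only [Pi.smul_apply, smul_eq_mul]
    have := lt_of_le_of_ne (not_lt.1 hneg) hne
    linarith
  have := form_neg_of_mem hx hmem
  rw [form_smul_right] at this
  linarith

/-- The tangent space `p^⊥` of `Iⁿ` is spacelike. -/
theorem form_self_pos {n : ℕ} {p w : E n} (hp : p ∈ Hyp n) (hpw : form p w = 0) (hw : w ≠ 0) :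
    0 < form w w := by
  obtain ⟨hp1, hp0⟩ := hp
  have hcs := Finset.sum_mul_sq_le_sq_mul_sq Finset.univ
    (fun i : Fin n => p i.succ) (fun i : Fin n => w i.succ)
  simp only [form, ← pow_two] at hp1 hpw ⊢
  have hP : ∑ i : Fin n, p i.succ ^ 2 = p 0 ^ 2 - 1 := by linarith
  have hS : ∑ i : Fin n, p i.succ * w i.succ = p 0 * w 0 := by linarith
  rw [hP, hS] at hcs
  have hnn : 0 ≤ ∑ i : Fin n, w i.succ ^ 2 := Finset.sum_nonneg fun i _ => sq_nonneg _
  rcases hnn.eq_or_lt with h0 | h0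
  · exfalso
    have h1 : ∀ i : Fin n, w i.succ = 0 := fun i => by
      simpa using (Finset.sum_eq_zero_iff_of_nonneg fun i _ => sq_nonneg _).1 h0.symm i
        (Finset.mem_univ i)
    have h2 : w 0 = 0 := by
      simp only [h1, mul_zero, Finset.sum_const_zero] at hS
      exact (mul_eq_zero.1 hS.symm).resolve_left hp0.ne'
    exact hw (funext fun i => Fin.cases h2 h1 i)
  · have : 0 < p 0 ^ 2 * (-w 0 ^ 2 + ∑ i : Fin n, w i.succ ^ 2) := by nlinarith
    exact pos_of_mul_pos_right this (sq_nonneg _)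

theorem exists_unit_tangent {n : ℕ} {p w : E n} (hp : p ∈ Hyp n) (hpw : form p w = 0)
    (hw : w ≠ 0) : ∃ s : ℝ, 0 < s ∧ ∃ v, w = s • v ∧ form p v = 0 ∧ form v v = 1 := by
  have hpos := form_self_pos hp hpw hw
  have hs := Real.sqrt_pos.2 hpos
  refine ⟨Real.sqrt (form w w), hs, (Real.sqrt (form w w))⁻¹ • w, ?_, ?_, ?_⟩
  · rw [smul_smul, mul_inv_cancel₀ hs.ne', one_smul]
  · rw [form_smul_right, hpw, mul_zero]
  · rw [form_smul_left, form_smul_right]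
    nth_rewrite 3 [← Real.sq_sqrt hpos.le]
    field_simp

/-- Two distinct points of `Iⁿ` are joined by a geodesic, whose velocity lies in their span. -/
theorem exists_geodesic {n : ℕ} {p q : E n} (hp : p ∈ Hyp n) (hq : q ∈ Hyp n) (hqp : q ≠ p) :
    ∃ v t, 0 < t ∧ form p v = 0 ∧ form v v = 1 ∧ q = geodesic p v t ∧
      ∀ u, form p u = 0 → form q u = 0 → form v u = 0 := by
  have hneg := form_neg_of_mem hp hq
  have hpw : form p (q + form p q • p) = 0 := by
    rw [form_add_right, form_smul_right, hp.1]; ring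
  have hw : q + form p q • p ≠ 0 := by
    intro h
    have h1 : q = (-form p q) • p := by rw [neg_smul]; exact eq_neg_of_add_eq_zero_left h
    have h2 : form p q ^ 2 = 1 := by
      have h3 : form q q = form ((-form p q) • p) ((-form p q) • p) := by rw [← h1]
      rw [form_smul_left, form_smul_right, hp.1, hq.1] at h3
      linarith
    have h4 : form p q = -1 := by
      rcases mul_self_eq_one_iff.1 (pow_two (form p q) ▸ h2) with h | h <;> linarith
    rw [h4] at h1
    exact hqp (by simpa using h1)
  obtain ⟨s, hs, v, hv, hpv, hvv⟩ := exists_unit_tangent hp hpw hw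
  have hq' : q = (-form p q) • p + s • v := by rw [← hv]; module
  refine ⟨v, Real.arsinh s, Real.arsinh_pos_iff.2 hs, hpv, hvv, ?_, ?_⟩
  · have h1 : form q q = -form p q ^ 2 + s ^ 2 := by
      have : form q q = form ((-form p q) • p + s • v) ((-form p q) • p + s • v) := by rw [← hq']
      rw [this]
      simp only [form_add_left, form_add_right, form_smul_left, form_smul_right, hp.1, hpv, hvv,
        form_comm v p]
      ring
    rw [hq.1] at h1
    have h2 : Real.cosh (Real.arsinh s) = -form p q := by
      rw [Real.cosh_arsinh, show 1 + s ^ 2 = (-form p q) ^ 2 by linarith,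
        Real.sqrt_sq (by linarith)]
    rw [geodesic, h2, Real.sinh_arsinh, ← hq']
  · intro u hpu hqu
    have : s * form v u = 0 := by
      rw [← form_smul_left, ← hv, form_add_left, form_smul_left, hpu, hqu]; ring
    exact (mul_eq_zero.1 this).resolve_left hs.ne'

/-- A linear functional that does not vanish on `T_p Iⁿ` is there a multiple of the product
with a unit normal vector. -/
theorem exists_normal {n : ℕ} {p : E n} (hp : p ∈ Hyp n) (l : E n →L[ℝ] ℝ)
    (hl : ∃ v, form p v = 0 ∧ l v ≠ 0) :
    ∃ u ∈ dS n, form p u = 0 ∧ ∃ c : ℝ, ∀ v, form p v = 0 → l v = c * form v u := by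
  let w : E n := Fin.cons (-(l (Pi.single 0 1))) fun i => l (Pi.single i.succ 1)
  have hw : ∀ v, form v w = l v := by
    intro v
    conv_rhs => rw [pi_eq_sum_univ' v]
    simp [form, w, Fin.sum_univ_succ]
  have hpw : form p (w + form p w • p) = 0 := by
    rw [form_add_right, form_smul_right, hp.1]; ring
  have hv : ∀ v, form p v = 0 → form v (w + form p w • p) = l v := by
    intro v hv
    rw [form_add_right, form_smul_right, form_comm v p, hv, hw]; ring
  have hne : w + form p w • p ≠ 0 := by
    obtain ⟨v, hpv, hlv⟩ := hl
    intro h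
    rw [← hv v hpv, h] at hlv
    exact hlv (by simp [form])
  obtain ⟨s, -, u, hu, hpu, huu⟩ := exists_unit_tangent hp hpw hne
  refine ⟨u, huu, hpu, s, fun v hpv => ?_⟩
  rw [← hv v hpv, hu, form_smul_right]

/-! ### Totally geodesic hyperplanes -/

theorem form_eq_zero_of_polar_subset {n : ℕ} {u : E n} {v p w : E n} (hp : p ∈ polar u)
    (h : polar u ⊆ polar v) (hpw : form p w = 0) (hwu : form w u = 0) : form w v = 0 := by
  rcases eq_or_ne w 0 with rfl | hw
  · simp [form]
  obtain ⟨s, hs, x, rfl, hpx, hxx⟩ := exists_unit_tangent hp.1 hpw hw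
  have hxu : form x u = 0 := by
    rw [form_smul_left] at hwu
    exact (mul_eq_zero.1 hwu).resolve_left hs.ne'
  have hm : geodesic p x 1 ∈ polar u := by
    refine ⟨geodesic_mem_hyp hp.1 hpx hxx 1, ?_⟩
    simp only [geodesic, form_add_left, form_smul_left, hp.2, hxu]; ring
  have h1 := (h hm).2
  simp only [geodesic, form_add_left, form_smul_left, (h hp).2, mul_zero, zero_add] at h1
  rw [form_smul_left, (mul_eq_zero.1 h1).resolve_left (Real.sinh_pos_iff.2 one_pos).ne', mul_zero]

theorem eq_or_eq_neg_of_polar_eq {n : ℕ} {u v : E n} (hu : u ∈ dS n) (hv : v ∈ dS n)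
    (h : polar u = polar v) : u = v ∨ u = -v := by
  obtain ⟨p, hp⟩ := polar_nonempty hv
  have huu : form u u = 1 := hu
  have hvv : form v v = 1 := hv
  have hpu : form p u = 0 := (h.symm ▸ hp : p ∈ polar u).2
  set w : E n := u - form u v • v with hw
  have hu' : u = w + form u v • v := by rw [hw]; abel
  have hsub : ∀ z, form w z = form u z - form u v * form v z := fun z => by
    have : form u z = form (w + form u v • v) z := by rw [← hu']
    rw [form_add_left, form_smul_left] at this; linarith
  have hwv : form w v = 0 := by rw [hsub, hvv]; ring
  have hpw : form p w = 0 := by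
    rw [form_comm, hsub, form_comm u p, form_comm v p, hpu, hp.2]; ring
  have hwu : form w u = 0 := form_eq_zero_of_polar_subset hp h.symm.le hpw hwv
  have hw0 : w = 0 := by
    by_contra hne
    have := form_self_pos hp.1 hpw hne
    rw [hsub, form_comm u w, form_comm v w, hwu, hwv] at this
    simp at this
  rw [hw0, zero_add] at hu'
  have h1 : form u v ^ 2 = 1 := by
    have : form u u = form (form u v • v) (form u v • v) := by rw [← hu']
    rw [huu, form_smul_left, form_smul_right, hvv] at this
    linarith
  rcases mul_self_eq_one_iff.1 (pow_two (form u v) ▸ h1) with h2 | h2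
  · left; rw [hu', h2, one_smul]
  · right; rw [hu', h2, neg_one_smul]

theorem continuous_geodesic {n : ℕ} (p v : E n) : Continuous (geodesic p v) := by
  unfold geodesic
  exact (Real.continuous_cosh.smul continuous_const).add
    (Real.continuous_sinh.smul continuous_const)

theorem hasDerivAt_geodesic {n : ℕ} (p v : E n) (t : ℝ) :
    HasDerivAt (geodesic p v) (Real.sinh t • p + Real.cosh t • v) t :=
  ((Real.hasDerivAt_cosh t).smul_const p).add ((Real.hasDerivAt_sinh t).smul_const v)

theorem geodesic_zero {n : ℕ} (p v : E n) : geodesic p v 0 = p := by simp [geodesic]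

/-- If the hypersurface `P = {f = 0}` contains `P_u` near a point `q`, then `f` has nonzero derivative
in the normal direction `u`. -/
theorem fderiv_ne_zero_of_polar_subset {n : ℕ} {P : Set (E n)} {u q : E n} {f : E n → ℝ}
    (hu : u ∈ dS n) (hsub : polar u ⊆ P) (hq : q ∈ polar u)
    (hf : IsDefiningFunctionAt P q f) : fderiv ℝ f q u ≠ 0 := by
  have huu : form u u = 1 := hu
  have hd : DifferentiableAt ℝ f q := hf.smooth.differentiableAt (by simp)
  -- `f` vanishes along the geodesics of `P_u`
  have htan : ∀ w, form q w = 0 → form w u = 0 → fderiv ℝ f q w = 0 := by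
    intro w hqw hwu
    rcases eq_or_ne w 0 with rfl | hw
    · simp
    obtain ⟨s, hs, v, rfl, hqv, hvv⟩ := exists_unit_tangent hq.1 hqw hw
    have hvu : form v u = 0 := by
      rw [form_smul_left] at hwu
      exact (mul_eq_zero.1 hwu).resolve_left hs.ne'
    have hm : ∀ t, geodesic q v t ∈ polar u := fun t => by
      refine ⟨geodesic_mem_hyp hq.1 hqv hvv t, ?_⟩
      simp only [geodesic, form_add_left, form_smul_left, hq.2, hvu]; ring
    have htend : Tendsto (geodesic q v) (𝓝 0) (𝓝[Hyp n] q) := by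
      refine tendsto_nhdsWithin_iff.2 ⟨?_, Eventually.of_forall fun t => (hm t).1⟩
      have := (continuous_geodesic q v).tendsto 0
      rwa [geodesic_zero] at this
    have h0 : (fun t => f (geodesic q v t)) =ᶠ[𝓝 0] fun _ => 0 := by
      filter_upwards [htend.eventually hf.zeroSet] with t ht using ht.1 (hsub (hm t))
    have h1 : HasDerivAt (fun t => f (geodesic q v t)) (fderiv ℝ f q v) 0 := by
      have hg := hasDerivAt_geodesic q v 0
      simp only [Real.sinh_zero, zero_smul, Real.cosh_zero, one_smul, zero_add] at hg
      refine HasFDerivAt.comp_hasDerivAt (l := f) (0 : ℝ) ?_ hg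
      rw [geodesic_zero]; exact hd.hasFDerivAt
    have h2 := h1.unique ((hasDerivAt_const (0 : ℝ) (0 : ℝ)).congr_of_eventuallyEq h0)
    rw [map_smul, h2, smul_zero]
  obtain ⟨w, hqw, hfw⟩ := hf.regular
  intro h
  apply hfw
  have h1 : fderiv ℝ f q (w - form w u • u) = 0 := by
    rw [sub_eq_add_neg, ← neg_smul]
    refine htan _ ?_ ?_
    · rw [form_add_right, form_smul_right, hqw, hq.2]; ring
    · rw [form_add_left, form_smul_left, huu]; ring
  rwa [map_sub, map_smul, h, smul_zero, sub_zero] at h1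

/-- A hypersurface that contains `P_u` coincides with it near every point of `P_u`: a nearby point
`x = cosh s x' + sinh s u` of the hypersurface with foot `x' ∈ P_u` has `s = 0` by Rolle's theorem for
the defining function on the geodesic from `x'` to `x`. -/
theorem eventually_form_eq_zero {n : ℕ} {P : Set (E n)} {u q : E n} {f : E n → ℝ}
    (hu : u ∈ dS n) (hP : P ⊆ Hyp n) (hsub : polar u ⊆ P) (hq : q ∈ polar u)
    (hf : IsDefiningFunctionAt P q f) : ∀ᶠ x in 𝓝[P] q, form x u = 0 := by
  have huu : form u u = 1 := hu
  have hne := fderiv_ne_zero_of_polar_subset hu hsub hq hf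
  have hcd : ContDiffAt ℝ 1 f q := hf.smooth.of_le (by exact_mod_cast le_top)
  have hcont : Tendsto (fun z : E n × ℝ => geodesic z.1 u z.2) (𝓝 (q, 0)) (𝓝 q) := by
    have : Continuous fun z : E n × ℝ => geodesic z.1 u z.2 := by unfold geodesic; fun_prop
    have h := this.tendsto (q, 0)
    rwa [geodesic_zero] at h
  have hgood : ∀ᶠ z : E n × ℝ in 𝓝 (q, 0), DifferentiableAt ℝ f (geodesic z.1 u z.2) ∧
      fderiv ℝ f (geodesic z.1 u z.2) (Real.sinh z.2 • z.1 + Real.cosh z.2 • u) ≠ 0 := by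
    refine Eventually.and (hcont.eventually ?_) ?_
    · exact (hcd.eventually (by simp)).mono fun y hy => hy.differentiableAt one_ne_zero
    · have h1 : Tendsto (fderiv ℝ f) (𝓝 q) (𝓝 (fderiv ℝ f q)) :=
        (hcd.fderiv_right (m := 0) (by simp)).continuousAt
      have h2 : Tendsto (fun z : E n × ℝ => Real.sinh z.2 • z.1 + Real.cosh z.2 • u) (𝓝 (q, 0))
          (𝓝 u) := by
        have : Continuous fun z : E n × ℝ => Real.sinh z.2 • z.1 + Real.cosh z.2 • u := by fun_prop
        have h := this.tendsto (q, 0)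
        simpa using h
      have h3 := (isBoundedBilinearMap_apply (𝕜 := ℝ) (E := E n) (F := ℝ)).continuous.tendsto
        (fderiv ℝ f q, u)
      exact (h3.comp ((h1.comp hcont).prodMk_nhds h2)).eventually_ne hne
  obtain ⟨ε, hε, hball⟩ := Metric.eventually_nhds_iff_ball.1 hgood
  -- the foot of the perpendicular from `x` to `P_u`
  let foot : E n → E n := fun x => (Real.sqrt (1 + form x u ^ 2))⁻¹ • (x - form x u • u)
  have hformc : Continuous fun x : E n => form x u := (formCLM u).continuous
  have hpos : ∀ x : E n, 0 < 1 + form x u ^ 2 := fun x => by positivity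
  have hfootc : Continuous foot := by
    refine Continuous.smul (Continuous.inv₀ ((hformc.pow 2).const_add 1).sqrt fun x =>
      (Real.sqrt_pos.2 (hpos x)).ne') (continuous_id.sub (hformc.smul continuous_const))
  have hfootq : foot q = q := by simp [foot, hq.2]
  have hfootm : ∀ x ∈ Hyp n, foot x ∈ polar u := by
    intro x hx
    have hs := Real.sqrt_pos.2 (hpos x)
    have hs2 := Real.sq_sqrt (hpos x).le
    have e1 : form (foot x) u = 0 := by
      simp only [foot, sub_eq_add_neg, ← neg_smul, form_smul_left, form_add_left, huu]; ring
    have e2 : form x (foot x) = -Real.sqrt (1 + form x u ^ 2) := by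
      simp only [foot, sub_eq_add_neg, ← neg_smul, form_smul_right, form_add_right, hx.1]
      field_simp; rw [hs2]; ring
    refine ⟨mem_hyp_of_form_neg hx ?_ (by rw [e2]; linarith), e1⟩
    have e3 : form (foot x) (foot x) = (Real.sqrt (1 + form x u ^ 2))⁻¹ * form x (foot x) := by
      conv_lhs => rw [form_comm]; simp only [foot]
      rw [form_smul_right, sub_eq_add_neg, ← neg_smul, form_add_right, form_smul_right,
        show form ((Real.sqrt (1 + form x u ^ 2))⁻¹ • (x + -form x u • u)) u = 0 by
          simpa only [foot, sub_eq_add_neg, ← neg_smul] using e1, form_comm _ x]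
      simp only [foot, sub_eq_add_neg, ← neg_smul]; ring
    rw [e3, e2]; field_simp
  have hgeo : ∀ x, geodesic (foot x) u (Real.arsinh (form x u)) = x := by
    intro x
    have hs := Real.sqrt_pos.2 (hpos x)
    rw [geodesic, Real.cosh_arsinh, Real.sinh_arsinh]
    simp only [foot]
    rw [smul_smul, mul_inv_cancel₀ hs.ne', one_smul, sub_add_cancel]
  have hle : 𝓝[P] q ≤ 𝓝[Hyp n] q := nhdsWithin_mono _ hP
  have hfoot_tend : Tendsto foot (𝓝[P] q) (𝓝[Hyp n] q) := by
    refine tendsto_nhdsWithin_iff.2 ⟨?_, ?_⟩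
    · have := hfootc.tendsto q
      rw [hfootq] at this
      exact this.mono_left nhdsWithin_le_nhds
    · filter_upwards [self_mem_nhdsWithin] with x hx using (hfootm x (hP hx)).1
  have h1 : ∀ᶠ x in 𝓝[P] q, foot x ∈ Metric.ball q ε :=
    hfoot_tend.eventually (nhdsWithin_le_nhds (Metric.ball_mem_nhds q hε))
  have h2 : ∀ᶠ x in 𝓝[P] q, |Real.arsinh (form x u)| < ε := by
    have hc : Continuous fun x : E n => |Real.arsinh (form x u)| :=
      (Real.continuous_arsinh.comp hformc).abs
    have := hc.tendsto q
    simp only [hq.2, Real.arsinh_zero, abs_zero] at this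
    exact nhdsWithin_le_nhds (this.eventually_lt_const hε)
  filter_upwards [h1, h2, hle hf.zeroSet, hfoot_tend.eventually hf.zeroSet,
    self_mem_nhdsWithin] with x hx1 hx2 hx3 hx4 hxP
  set s := Real.arsinh (form x u) with hs
  by_contra hx0
  have hs0 : s ≠ 0 := fun h => hx0 (Real.arsinh_eq_zero_iff.1 h)
  have hmem : ∀ τ ∈ Icc (0 : ℝ) 1, (foot x, s * τ) ∈ Metric.ball (q, (0 : ℝ)) ε := by
    intro τ hτ
    rw [← ball_prod_same]
    refine ⟨hx1, ?_⟩
    rw [Metric.mem_ball, dist_zero_right, Real.norm_eq_abs, abs_mul, abs_of_nonneg hτ.1]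
    exact (mul_le_of_le_one_right (abs_nonneg _) hτ.2).trans_lt hx2
  have hderiv : ∀ τ ∈ Icc (0 : ℝ) 1, HasDerivAt (fun τ => f (geodesic (foot x) u (s * τ)))
      (fderiv ℝ f (geodesic (foot x) u (s * τ))
        (s • (Real.sinh (s * τ) • foot x + Real.cosh (s * τ) • u))) τ := by
    intro τ hτ
    have hin : HasDerivAt (fun τ : ℝ => s * τ) s τ := by simpa using (hasDerivAt_id τ).const_mul s
    exact (hball _ (hmem τ hτ)).1.hasFDerivAt.comp_hasDerivAt τ
      ((hasDerivAt_geodesic (foot x) u (s * τ)).scomp τ hin)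
  obtain ⟨τ, hτ, hτ0⟩ := exists_hasDerivAt_eq_zero (f := fun τ => f (geodesic (foot x) u (s * τ)))
    zero_lt_one (fun τ hτ => (hderiv τ hτ).continuousAt.continuousWithinAt)
    (by
      simp only [mul_zero, geodesic_zero, mul_one, hs, hgeo]
      rw [hx4.1 (hsub (hfootm x (hP hxP))), hx3.1 hxP])
    (fun τ hτ => hderiv τ (Ioo_subset_Icc_self hτ))
  rw [map_smul] at hτ0
  exact (hball _ (hmem τ (Ioo_subset_Icc_self hτ))).2
    ((smul_eq_zero.1 hτ0).resolve_left hs0)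

/-- Every totally geodesic hyperplane is of the form `P_u`: it contains the geodesics from one of its
points orthogonal to its normal `u` there, hence `P_u`, and `P_u` is open and closed in it. -/
theorem IsTotallyGeodesicHyperplane.exists_eq_polar {n : ℕ} {P : Set (E n)}
    (hP : IsTotallyGeodesicHyperplane P) : ∃ u : dS n, polar (u : E n) = P := by
  obtain ⟨p, hp⟩ := hP.connected.nonempty
  have hpH := hP.subset hp
  obtain ⟨f, hf, hgeo⟩ := hP.totallyGeodesic p hp
  obtain ⟨u, hu, hpu, c, hc⟩ := exists_normal hpH (fderiv ℝ f p) hf.regular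
  have hsub : polar u ⊆ P := by
    intro q hq
    rcases eq_or_ne q p with rfl | hqp
    · exact hp
    obtain ⟨v, t, -, hpv, hvv, rfl, hv⟩ := exists_geodesic hpH hq.1 hqp
    exact hgeo v hpv hvv (by rw [hc v hpv, hv u hpu hq.2, mul_zero]) t
  refine ⟨⟨u, hu⟩, hsub.antisymm ?_⟩
  have : PreconnectedSpace P := isPreconnected_iff_preconnectedSpace.1 hP.connected.isPreconnected
  have hclopen : IsClopen {x : P | form x.1 u = 0} := by
    refine ⟨isClosed_eq ((formCLM u).continuous.comp continuous_subtype_val) continuous_const, ?_⟩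
    rw [isOpen_iff_mem_nhds]
    intro q hq
    obtain ⟨fq, hfq, -⟩ := hP.totallyGeodesic q.1 q.2
    exact preimage_coe_mem_nhds_subtype.2
      (eventually_form_eq_zero hu hP.subset hsub ⟨hP.subset q.2, hq⟩ hfq)
  have huniv := hclopen.eq_univ ⟨⟨p, hp⟩, hpu⟩
  intro x hx
  exact ⟨hP.subset hx, (huniv ▸ mem_univ (⟨x, hx⟩ : P) : (⟨x, hx⟩ : P) ∈ {x : P | form x.1 u = 0})⟩

theorem toOm_surjective (n : ℕ) : Function.Surjective (toOm (n := n)) := fun H => by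
  obtain ⟨u, hu⟩ := H.2.exists_eq_polar
  exact ⟨u, Subtype.ext hu⟩

theorem toOm_eq_iff {n : ℕ} (u v : dS n) : toOm u = toOm v ↔ (u : E n) = v ∨ (u : E n) = -v := by
  constructor
  · intro h
    exact eq_or_eq_neg_of_polar_eq u.2 v.2 (congrArg Subtype.val h)
  · rintro (h | h)
    · rw [Subtype.ext h]
    · refine Subtype.ext ?_
      ext x
      have : form x (-v.1) = -form x v.1 := by
        rw [← neg_one_smul ℝ v.1, form_smul_right, neg_one_mul]
      simp [toOm, polar, h, this]

/-- `dSⁿ/{±1} ≃ Ω`, induced by `u ↦ P_u`. -/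
def quotientEquivOm (n : ℕ) : Quotient (signSetoid n) ≃ᵐ Om n where
  toEquiv := Equiv.ofBijective (Quotient.lift toOm fun u v h => (toOm_eq_iff u v).2 h) (by
    constructor
    · intro a b
      induction a using Quotient.inductionOn
      induction b using Quotient.inductionOn
      exact fun h => Quotient.sound ((toOm_eq_iff _ _).1 h)
    · intro H
      obtain ⟨u, rfl⟩ := toOm_surjective n H
      exact ⟨Quotient.mk _ u, rfl⟩)
  measurable_toFun := measurable_from_quotient.2 fun A hA => hA
  measurable_invFun := by
    intro B hB
    have hB' : MeasurableSet (Quotient.mk (signSetoid n) ⁻¹' B) := hB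
    change MeasurableSet (toOm ⁻¹' _)
    convert hB' using 1
    ext u
    rw [mem_preimage, mem_preimage, mem_preimage]
    refine Eq.to_iff (congrArg (· ∈ B) ?_)
    exact (Equiv.symm_apply_eq _).2 rfl

/-! ### The action on hyperplanes -/

theorem form_neg_neg {n : ℕ} (x y : E n) : form (-x) (-y) = form x y := by simp [form]

theorem form_neg_left {n : ℕ} (x y : E n) : form (-x) y = -form x y := by
  rw [← neg_one_smul ℝ x, form_smul_left, neg_one_mul]

theorem actHyp_mem {n : ℕ} (g : lorentzGroup n) {x : E n} (hx : x ∈ Hyp n) :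
    actHyp g x ∈ Hyp n := by
  have h1 : form (g.1 x) (g.1 x) = -1 := (g.2 x x).trans hx.1
  unfold actHyp
  split_ifs with h
  · exact ⟨h1, h⟩
  · refine ⟨by rw [form_neg_neg, h1], ?_⟩
    have hne : g.1 x 0 ≠ 0 := by
      intro h0
      have : (0 : ℝ) ≤ form (g.1 x) (g.1 x) := by
        simp only [form, h0, mul_zero, neg_zero, zero_add]
        exact Finset.sum_nonneg fun i _ => mul_self_nonneg _
      linarith
    have := lt_of_le_of_ne (not_lt.1 h) hne
    simpa using this

theorem actHyp_actHyp_inv {n : ℕ} (g : lorentzGroup n) {x : E n} (hx : x ∈ Hyp n) :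
    actHyp g (actHyp g⁻¹ x) = x := by
  have hg : g.1 ((g⁻¹).1 x) = x := g.1.apply_symm_apply x
  have hx0 := hx.2
  have hx0' : ¬ 0 < -(x 0) := by linarith
  by_cases h : 0 < (g⁻¹).1 x 0
  · simp only [actHyp, if_pos h, hg, if_pos hx0]
  · simp only [actHyp, if_neg h, map_neg, hg, Pi.neg_apply, if_neg hx0', neg_neg]

theorem form_actHyp_eq_zero_iff {n : ℕ} (g : lorentzGroup n) (x u : E n) :
    form (actHyp g x) (g.1 u) = 0 ↔ form x u = 0 := by
  unfold actHyp
  split_ifs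
  · rw [g.2]
  · rw [form_neg_left, g.2, neg_eq_zero]

theorem image_actHyp_polar {n : ℕ} (g : lorentzGroup n) (u : E n) :
    actHyp g '' polar u = polar (g.1 u) := by
  ext y
  constructor
  · rintro ⟨x, hx, rfl⟩
    exact ⟨actHyp_mem g hx.1, (form_actHyp_eq_zero_iff g x u).2 hx.2⟩
  · intro hy
    refine ⟨actHyp g⁻¹ y, ⟨actHyp_mem g⁻¹ hy.1, ?_⟩, actHyp_actHyp_inv g hy.1⟩
    rw [← form_actHyp_eq_zero_iff g, actHyp_actHyp_inv g hy.1, hy.2]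

theorem measurable_toOm (n : ℕ) : Measurable (toOm (n := n)) := fun _ hA => hA

theorem exists_measurePreserving_actOm {n : ℕ} (hn : 1 ≤ n) (g : lorentzGroup n) :
    ∃ φ : Om n → Om n, (∀ H : Om n, (φ H : Set (E n)) = actHyp g '' (H : Set (E n))) ∧
      MeasurePreserving φ (mu n) (mu n) := by
  have hH : ∀ H : Om n, IsTotallyGeodesicHyperplane (actHyp g '' (H : Set (E n))) := by
    intro H
    obtain ⟨u, rfl⟩ := toOm_surjective n H
    have : actHyp g '' ((toOm u : Om n) : Set (E n)) = polar (actDS g u : E n) :=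
      image_actHyp_polar g u.1
    rw [this]
    exact polar_isTotallyGeodesicHyperplane (actDS g u).2
  let φ : Om n → Om n := fun H => ⟨_, hH H⟩
  have hcomm : φ ∘ toOm = toOm ∘ actDS g :=
    funext fun u => Subtype.ext (image_actHyp_polar g u.1)
  have hφ : Measurable φ := by
    intro A hA
    change MeasurableSet (toOm ⁻¹' (φ ⁻¹' A))
    rw [← preimage_comp, hcomm]
    exact (measurable_toOm n).comp (measurable_actDS g) hA
  refine ⟨φ, fun _ => rfl, hφ, ?_⟩
  rw [mu, Measure.map_map hφ (measurable_toOm n), hcomm,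
    ← Measure.map_map (measurable_toOm n) (measurable_actDS g), (measurePreserving_actDS hn g).map_eq]

/-! ### Separating hyperplanes -/

theorem form_geodesic_left {n : ℕ} (p v u : E n) (t : ℝ) :
    form (geodesic p v t) u = Real.cosh t * form p u + Real.sinh t * form v u := by
  simp only [geodesic, form_add_left, form_smul_left]

/-- Each point of a geodesic segment is a positive combination of its endpoints. -/
theorem sinh_smul_geodesic {n : ℕ} (p v : E n) (a t : ℝ) :
    Real.sinh t • geodesic p v a = Real.sinh (t - a) • p + Real.sinh a • geodesic p v t := by
  simp only [geodesic, Real.sinh_sub]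
  module

theorem form_geodesic_geodesic {n : ℕ} {p v : E n} (hp : p ∈ Hyp n) (hpv : form p v = 0)
    (hv : form v v = 1) (s t : ℝ) :
    form (geodesic p v s) (geodesic p v t) = -Real.cosh (t - s) := by
  simp only [geodesic, form_add_left, form_add_right, form_smul_left, form_smul_right, hpv,
    form_comm v p, hv, hp.1, Real.cosh_sub]
  ring

theorem form_lt_neg_one {n : ℕ} {x y : E n} (hx : x ∈ Hyp n) (hy : y ∈ Hyp n) (h : y ≠ x) :
    form x y < -1 := by
  obtain ⟨v, t, ht, hxv, hvv, rfl, -⟩ := exists_geodesic hx hy h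
  have := form_geodesic_geodesic hx hxv hvv 0 t
  rw [geodesic_zero, sub_zero] at this
  rw [this]
  linarith [Real.one_lt_cosh.2 ht.ne']

theorem cosh_hypDist {n : ℕ} {x y : E n} (hx : x ∈ Hyp n) (hy : y ∈ Hyp n) :
    Real.cosh (hypDist x y) = -form x y := by
  refine Real.cosh_arcosh ?_
  rcases eq_or_ne y x with rfl | h
  · rw [hy.1]; norm_num
  · linarith [form_lt_neg_one hx hy h]

/-- `P_u` separates two points of `Iⁿ` iff they lie strictly on different sides of it: the sides are
geodesically convex, and on a connected set avoiding `P_u` the function `⟨·, u⟩` has constant sign. -/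
theorem separates_polar_iff {n : ℕ} {u x y : E n} (hx : x ∈ Hyp n) (hy : y ∈ Hyp n) :
    Separates (polar u) x y ↔ form x u * form y u < 0 := by
  constructor
  · rintro ⟨⟨-, hx'⟩, ⟨-, hy'⟩, hsep⟩
    have hx0 : form x u ≠ 0 := fun h => hx' ⟨hx, h⟩
    have hy0 : form y u ≠ 0 := fun h => hy' ⟨hy, h⟩
    by_contra hneg
    have hpos : 0 < form x u * form y u := lt_of_le_of_ne (not_lt.1 hneg) (mul_ne_zero hx0 hy0).symm
    apply hsep
    rcases eq_or_ne y x with rfl | hne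
    · exact mem_connectedComponentIn ⟨hx, hx'⟩
    obtain ⟨v, t, ht, hxv, hvv, rfl, -⟩ := exists_geodesic hx hy hne
    have hpre : IsPreconnected (geodesic x v '' Icc 0 t) :=
      isPreconnected_Icc.image _ (continuous_geodesic x v).continuousOn
    refine hpre.subset_connectedComponentIn ⟨0, ⟨le_rfl, ht.le⟩, geodesic_zero x v⟩ ?_
      ⟨t, ⟨ht.le, le_rfl⟩, rfl⟩
    rintro _ ⟨a, ⟨ha0, hat⟩, rfl⟩
    refine ⟨geodesic_mem_hyp hx hxv hvv a, fun hmem => ?_⟩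
    have h1 := congrArg (fun z => form z u) (sinh_smul_geodesic x v a t)
    simp only [form_smul_left, form_add_left, hmem.2, mul_zero] at h1
    have h2 : 0 ≤ Real.sinh (t - a) := Real.sinh_nonneg_iff.2 (by linarith)
    have h3 : 0 ≤ Real.sinh a := Real.sinh_nonneg_iff.2 ha0
    have h4 : Real.sinh (t - a) * form x u ^ 2 +
        Real.sinh a * (form x u * form (geodesic x v t) u) = 0 := by
      linear_combination -(form x u) * h1
    have h5 := mul_nonneg h2 (sq_nonneg (form x u))
    have h6 := mul_nonneg h3 hpos.le
    rcases ha0.eq_or_lt with h | h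
    · have : 0 < Real.sinh (t - a) := Real.sinh_pos_iff.2 (by linarith)
      have := mul_pos this (pow_pos (abs_pos.2 hx0) 2)
      rw [sq_abs] at this
      linarith
    · have := mul_pos (Real.sinh_pos_iff.2 h) hpos
      linarith
  · intro h
    have hx0 : form x u ≠ 0 := left_ne_zero_of_mul h.ne
    have hy0 : form y u ≠ 0 := right_ne_zero_of_mul h.ne
    refine ⟨⟨hx, fun hm => hx0 hm.2⟩, ⟨hy, fun hm => hy0 hm.2⟩, fun hc => ?_⟩
    have hxc := mem_connectedComponentIn (F := Hyp n \ polar u) ⟨hx, fun hm => hx0 hm.2⟩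
    have hpre : IsPreconnected (connectedComponentIn (Hyp n \ polar u) x) :=
      isPreconnected_connectedComponentIn
    have hcont : ContinuousOn (fun z => form z u) (connectedComponentIn (Hyp n \ polar u) x) :=
      (formCLM u).continuous.continuousOn
    have h0 : (0 : ℝ) ∈ (fun z => form z u) '' connectedComponentIn (Hyp n \ polar u) x := by
      rcases lt_or_gt_of_ne hx0 with h' | h'
      · exact hpre.intermediate_value hxc hc hcont ⟨h'.le, (pos_of_mul_neg_right h h'.le).le⟩
      · exact hpre.intermediate_value hc hxc hcont ⟨(neg_of_mul_neg_right h h'.le).le, h'.le⟩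
    obtain ⟨z, hz, hz0⟩ := h0
    have := connectedComponentIn_subset _ _ hz
    exact this.2 ⟨this.1, hz0⟩

/-! ### Transitivity of the Lorentz group on pairs of points -/

/-- The reflection in the hyperplane orthogonal to a vector `w` that is not null. -/
def lorentzReflection {n : ℕ} (w : E n) (hw : form w w ≠ 0) : lorentzGroup n :=
  ⟨LinearEquiv.ofInvolutive
    { toFun := fun z => z - (2 * form z w / form w w) • w
      map_add' := fun x y => by rw [form_add_left]; module
      map_smul' := fun a x => by rw [form_smul_left, RingHom.id_apply]; module }
    (fun z => by
      change (z - (2 * form z w / form w w) • w) -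
        (2 * form (z - (2 * form z w / form w w) • w) w / form w w) • w = z
      rw [sub_eq_add_neg z, ← neg_smul, form_add_left, form_smul_left]
      have : 2 * (form z w + -(2 * form z w / form w w) * form w w) / form w w =
          -(2 * form z w / form w w) := by field_simp; ring
      rw [this]; module), by
    intro x y
    change form (x - (2 * form x w / form w w) • w) (y - (2 * form y w / form w w) • w) = form x y
    simp only [sub_eq_add_neg, ← neg_smul, form_add_left, form_smul_left, form_add_right,
      form_smul_right, form_comm w y]
    field_simp; ring⟩

theorem lorentzReflection_apply {n : ℕ} (w : E n) (hw : form w w ≠ 0) (z : E n) :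
    (lorentzReflection w hw).1 z = z - (2 * form z w / form w w) • w := rfl

/-- One point of `Iⁿ` is taken to another one by the reflection in their bisector. -/
theorem exists_lorentz_apply_eq {n : ℕ} {x y : E n} (hx : x ∈ Hyp n) (hy : y ∈ Hyp n) :
    ∃ g : lorentzGroup n, g.1 x = y ∧ ∀ z, form z x = form z y → g.1 z = z := by
  rcases eq_or_ne y x with rfl | hne
  · exact ⟨1, rfl, fun _ _ => rfl⟩
  have hlt := form_lt_neg_one hx hy hne
  have hz : ∀ z, form z (x - y) = form z x - form z y := fun z => by
    rw [sub_eq_add_neg, form_add_right, form_comm z (-y), form_neg_left, form_comm y]; ring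
  have hww : form (x - y) (x - y) = 2 * form x (x - y) := by
    rw [hz, form_comm _ x, form_comm _ y, hz, hz, hx.1, hy.1, form_comm y x]; ring
  have hxw : form x (x - y) = -1 - form x y := by rw [hz, hx.1]
  refine ⟨lorentzReflection (x - y) (by rw [hww, hxw]; linarith), ?_, fun z h => ?_⟩
  · rw [lorentzReflection_apply, hww, div_self (by rw [hxw]; linarith), one_smul, sub_sub_cancel]
  · rw [lorentzReflection_apply, hz, h, sub_self, mul_zero, zero_div, zero_smul, sub_zero]

theorem exists_lorentz_apply_pair_eq {n : ℕ} {x y x' y' : E n} (hx : x ∈ Hyp n) (hy : y ∈ Hyp n)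
    (hx' : x' ∈ Hyp n) (hy' : y' ∈ Hyp n) (h : form x y = form x' y') :
    ∃ g : lorentzGroup n, g.1 x = x' ∧ g.1 y = y' := by
  obtain ⟨g, hg, -⟩ := exists_lorentz_apply_eq hx hx'
  have h1 : form x' (g.1 y) = form x y := by rw [← hg, g.2]
  have hgy : g.1 y ∈ Hyp n :=
    mem_hyp_of_form_neg hx' ((g.2 y y).trans hy.1) (by rw [h1]; exact form_neg_of_mem hx hy)
  obtain ⟨k, hk, hkfix⟩ := exists_lorentz_apply_eq hgy hy'
  refine ⟨k * g, ?_, hk⟩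
  change k.1 (g.1 x) = x'
  rw [hg]
  exact hkfix x' (h1.trans h)

/-! ### The measure of the set of separating hyperplanes -/

/-- The unit normals of the hyperplanes that separate `x` and `y`. -/
def sepNormals {n : ℕ} (x y : E n) : Set (dS n) := {u | form x u * form y u < 0}

theorem isOpen_sepNormals {n : ℕ} (x y : E n) : IsOpen (sepNormals x y) := by
  have h (z : E n) : Continuous fun u : dS n => form z u :=
    continuous_form.comp (continuous_const.prodMk continuous_subtype_val)
  exact isOpen_lt ((h x).mul (h y)) continuous_const

theorem muDS_sepNormals_lorentz {n : ℕ} (hn : 1 ≤ n) (g : lorentzGroup n) (x y : E n) :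
    muDS n (sepNormals (g.1 x) (g.1 y)) = muDS n (sepNormals x y) := by
  rw [← (measurePreserving_actDS hn g).measure_preimage
    (isOpen_sepNormals _ _).measurableSet.nullMeasurableSet]
  congr 1
  ext u
  change form (g.1 x) (g.1 u) * form (g.1 y) (g.1 u) < 0 ↔ form x u * form y u < 0
  rw [g.2, g.2]

theorem muDS_orthogonal_eq_zero {n : ℕ} (hn : 1 ≤ n) {y : E n} (hy : y ∈ Hyp n) :
    muDS n {u : dS n | form (u : E n) y = 0} = 0 := by
  have hm : MeasurableSet {u : dS n | form (u : E n) y = 0} :=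
    (isClosed_eq ((formCLM y).continuous.comp continuous_subtype_val) continuous_const).measurableSet
  have hker : (volume : Measure (E n)) (LinearMap.ker (formCLM y : E n →ₗ[ℝ] ℝ)) = 0 := by
    refine Measure.addHaar_submodule _ _ fun h => ?_
    have h1 : y ∈ LinearMap.ker (formCLM y : E n →ₗ[ℝ] ℝ) := h ▸ Submodule.mem_top
    have h2 : form y y = 0 := h1
    rw [hy.1] at h2
    norm_num at h2
  rw [muDS_apply hn hm, measure_mono_null ?_ hker, mul_zero]
  rintro _ ⟨⟨t, _⟩, ⟨-, u, hu, rfl⟩, rfl⟩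
  change form (t • u.1) y = 0
  rw [form_smul_left, show form u.1 y = 0 from hu, mul_zero]

/-- If `y` lies between `x` and `z`, then almost every hyperplane separating `x` and `z` separates `y`
from exactly one of them. -/
theorem muDS_sepNormals_add {n : ℕ} (hn : 1 ≤ n) {x y z : E n} (hy : y ∈ Hyp n) {a b : ℝ}
    (ha : 0 < a) (hb : 0 < b) (h : y = a • x + b • z) :
    muDS n (sepNormals x z) = muDS n (sepNormals x y) + muDS n (sepNormals y z) := by
  have hY : ∀ u : dS n, form y u = a * form x u + b * form z u := fun u => by
    rw [h, form_add_left, form_smul_left, form_smul_left]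
  have h1 : ∀ u : dS n, form x u * form y u < 0 → form x u * form z u < 0 := fun u hu => by
    rw [hY] at hu
    by_contra hneg
    nlinarith [mul_nonneg hb.le (not_lt.1 hneg), mul_nonneg ha.le (sq_nonneg (form x u))]
  have h2 : ∀ u : dS n, form y u * form z u < 0 → form x u * form z u < 0 := fun u hu => by
    rw [hY] at hu
    by_contra hneg
    nlinarith [mul_nonneg ha.le (not_lt.1 hneg), mul_nonneg hb.le (sq_nonneg (form z u))]
  have hprod : ∀ u : dS n, (form x u * form y u) * (form y u * form z u) =
    form y u ^ 2 * (form x u * form z u) := fun u => by ring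
  have hdisj : Disjoint (sepNormals x y) (sepNormals y z) := by
    rw [Set.disjoint_left]
    intro u hu hu'
    have := mul_pos_of_neg_of_neg (show form x u * form y u < 0 from hu)
      (show form y u * form z u < 0 from hu')
    rw [hprod] at this
    nlinarith [h1 u hu, sq_nonneg (form y u)]
  rw [← measure_union hdisj (isOpen_sepNormals y z).measurableSet]
  refine measure_congr (eventuallyEq_set.2 ?_)
  have hnull : ∀ᵐ u : dS n ∂(muDS n), form (u : E n) y ≠ 0 := by
    rw [ae_iff]
    simpa using muDS_orthogonal_eq_zero hn hy
  filter_upwards [hnull] with u hu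
  constructor
  · intro hxz
    have hlt : (form x u * form y u) * (form y u * form z u) < 0 := by
      rw [hprod]
      rw [form_comm] at hu
      exact mul_neg_of_pos_of_neg (by positivity) hxz
    by_contra hc
    rw [mem_union, not_or] at hc
    have := mul_nonneg
      (not_lt.1 (show ¬ form x u * form y u < 0 from hc.1))
      (not_lt.1 (show ¬ form y u * form z u < 0 from hc.2))
    linarith
  · rintro (hu | hu)
    · exact h1 u hu
    · exact h2 u hu

theorem abs_le_of_mem_dS {n : ℕ} {u : E n} (hu : u ∈ dS n) {C : ℝ} (hC : 0 ≤ C)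
    (h : 1 + u 0 ^ 2 ≤ C ^ 2) (i : Fin (n + 1)) : |u i| ≤ C := by
  refine abs_le_of_sq_le_sq ?_ hC
  refine Fin.cases (by linarith) (fun i => ?_) i
  have := Finset.single_le_sum (f := fun i : Fin n => u i.succ ^ 2) (fun i _ => sq_nonneg _)
    (Finset.mem_univ i)
  rw [sum_sq_eq_of_mem_dS hu] at this
  exact this.trans h

/-- Hyperplanes meeting a fixed geodesic segment have normals in a bounded part of `dSⁿ`. -/
theorem muDS_sepNormals_lt_top {n : ℕ} (hn : 1 ≤ n) (d : ℝ) :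
    muDS n (sepNormals (Pi.single 0 1)
      (geodesic (Pi.single 0 1) (Pi.single (Fin.succ ⟨0, hn⟩) 1) d)) < ⊤ := by
  set j : Fin n := ⟨0, hn⟩
  have hp : ∀ u : E n, form (Pi.single 0 1) u = -u 0 := fun u => by simp [form]
  have hv : ∀ u : E n, form (Pi.single j.succ 1) u = u j.succ := fun u => by
    simp [form, Pi.single_apply]
  rw [muDS_apply hn (isOpen_sepNormals _ _).measurableSet]
  refine ENNReal.mul_lt_top
    (ENNReal.add_lt_top.2 ⟨ENNReal.natCast_lt_top n, ENNReal.one_lt_top⟩) (lt_of_le_of_lt (measure_mono ?_)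
    (measure_closedBall_lt_top (x := (0 : E n)) (r := Real.cosh d)))
  rintro _ ⟨⟨t, _⟩, ⟨ht, u, hu, rfl⟩, rfl⟩
  have hu' : form (Pi.single 0 1) u.1 * form (geodesic (Pi.single 0 1) (Pi.single j.succ 1) d) u.1
    < 0 := hu
  rw [form_geodesic_left, hp, hv] at hu'
  have hj : u.1 j.succ ^ 2 ≤ 1 + u.1 0 ^ 2 := by
    rw [← sum_sq_eq_of_mem_dS u.2]
    exact Finset.single_le_sum (f := fun i : Fin n => u.1 i.succ ^ 2) (fun i _ => sq_nonneg _)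
      (Finset.mem_univ j)
  have hc := Real.cosh_pos d
  have hcs := Real.cosh_sq d
  have h0 : 1 + u.1 0 ^ 2 ≤ Real.cosh d ^ 2 := by
    have hlt : Real.cosh d * u.1 0 ^ 2 < Real.sinh d * u.1 0 * u.1 j.succ := by linarith
    have hsq : (Real.cosh d * u.1 0 ^ 2) ^ 2 < (Real.sinh d * u.1 0 * u.1 j.succ) ^ 2 :=
      pow_lt_pow_left₀ hlt (by positivity) two_ne_zero
    have hpos : 0 < u.1 0 ^ 2 := by
      refine lt_of_le_of_ne (sq_nonneg _) fun h => ?_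
      have h0 : u.1 0 = 0 := by simpa using h.symm
      simp [h0] at hlt
    have h3 : (Real.sinh d * u.1 0 * u.1 j.succ) ^ 2 ≤
        u.1 0 ^ 2 * (Real.sinh d ^ 2 * (1 + u.1 0 ^ 2)) := by
      have := mul_le_mul_of_nonneg_left hj (mul_nonneg (sq_nonneg (Real.sinh d)) hpos.le)
      linarith
    have h4 : u.1 0 ^ 2 * (Real.cosh d ^ 2 * u.1 0 ^ 2) <
        u.1 0 ^ 2 * (Real.sinh d ^ 2 * (1 + u.1 0 ^ 2)) := by linarith
    have h5 := lt_of_mul_lt_mul_left h4 hpos.le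
    rw [hcs] at h5 ⊢
    linarith
  rw [mem_closedBall_zero_iff, norm_smul, Real.norm_eq_abs, abs_of_pos ht.1]
  have h1 : ‖u.1‖ ≤ Real.cosh d :=
    (pi_norm_le_iff_of_nonneg hc.le).2 fun i => abs_le_of_mem_dS u.2 hc.le h0 i
  exact (mul_le_of_le_one_left (norm_nonneg _) ht.2.le).trans h1

theorem muDS_sepNormals_geodesic_pos {n : ℕ} (hn : 1 ≤ n) {p v : E n} (hp : p ∈ Hyp n)
    (hpv : form p v = 0) (hv : form v v = 1) : 0 < muDS n (sepNormals p (geodesic p v 1)) := by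
  rw [muDS_apply hn (isOpen_sepNormals _ _).measurableSet]
  refine ENNReal.mul_pos (by simp) ?_
  let O : Set (E n) := {z | (0 < form z z ∧ form z z < 1) ∧ form p z * form (geodesic p v 1) z < 0}
  have hsub : O ⊆ truncCone (sepNormals p (geodesic p v 1)) := by
    rintro z ⟨⟨h0, h1⟩, h2⟩
    have hs := Real.sqrt_pos.2 h0
    have hsq := Real.sq_sqrt h0.le
    set s := Real.sqrt (form z z) with hs_def
    have hz : z = s • (s⁻¹ • z) := by rw [smul_smul, mul_inv_cancel₀ hs.ne', one_smul]
    have hu : s⁻¹ • z ∈ dS n := by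
      change form _ _ = 1
      rw [form_smul_left, form_smul_right, ← hsq]
      field_simp
    have hmem : s • ((⟨s⁻¹ • z, hu⟩ : dS n) : E n) ∈ truncCone (sepNormals p (geodesic p v 1)) := by
      refine (smul_mem_truncCone_iff hs _).2 ⟨?_, ?_⟩
      · rw [hs_def, Real.sqrt_lt' one_pos]; simpa using h1
      · change form p (s⁻¹ • z) * form (geodesic p v 1) (s⁻¹ • z) < 0
        rw [form_smul_right, form_smul_right, mul_mul_mul_comm]
        exact mul_neg_of_pos_of_neg (by positivity) h2
    rwa [← hz] at hmem
  have hO : IsOpen O := by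
    have hzz : Continuous fun z : E n => form z z :=
      continuous_form.comp (continuous_id.prodMk continuous_id)
    have h (y : E n) : Continuous fun z : E n => form y z :=
      continuous_form.comp (continuous_const.prodMk continuous_id)
    exact ((isOpen_lt continuous_const hzz).inter (isOpen_lt hzz continuous_const)).inter
      (isOpen_lt ((h p).mul (h _)) continuous_const)
  -- a multiple of the normal to the hyperplane that bisects the segment
  have hne : O.Nonempty := by
    refine ⟨(2⁻¹ : ℝ) • (Real.sinh 2⁻¹ • p + Real.cosh 2⁻¹ • v), ?_⟩
    have hpos : 0 < Real.sinh (2⁻¹ : ℝ) := Real.sinh_pos_iff.2 (by norm_num)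
    have e1 : form (Real.sinh 2⁻¹ • p + Real.cosh 2⁻¹ • v) (Real.sinh 2⁻¹ • p + Real.cosh 2⁻¹ • v)
        = 1 := by
      simp only [form_add_left, form_add_right, form_smul_left, form_smul_right, hpv,
        form_comm v p, hv, hp.1]
      linear_combination Real.cosh_sq (2⁻¹ : ℝ)
    have e2 : form p (Real.sinh 2⁻¹ • p + Real.cosh 2⁻¹ • v) = -Real.sinh 2⁻¹ := by
      simp only [form_add_right, form_smul_right, hpv, hp.1]; ring
    have e3 : form (geodesic p v 1) (Real.sinh 2⁻¹ • p + Real.cosh 2⁻¹ • v) = Real.sinh 2⁻¹ := by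
      have : Real.sinh (2⁻¹ : ℝ) = Real.sinh (1 - 2⁻¹) := by norm_num
      conv_rhs => rw [this, Real.sinh_sub]
      simp only [geodesic, form_add_left, form_add_right, form_smul_left, form_smul_right, hpv,
        form_comm v p, hv, hp.1]
      ring
    simp only [O, mem_ofPred_eq, form_smul_left, form_smul_right, e1, e2, e3]
    refine ⟨by norm_num, ?_⟩
    nlinarith [mul_pos hpos hpos]
  exact ((hO.measure_pos volume hne).trans_le (measure_mono hsub)).ne'

/-- A nonnegative additive function on `[0, ∞)` is linear. -/
theorem eq_mul_of_additive_of_nonneg {f : ℝ → ℝ} (hadd : ∀ a b, 0 ≤ a → 0 ≤ b → f (a + b) = f a + f b)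
    (hf : ∀ a, 0 ≤ a → 0 ≤ f a) {a : ℝ} (ha : 0 ≤ a) : f a = f 1 * a := by
  have hmono : ∀ b c, 0 ≤ b → b ≤ c → f b ≤ f c := fun b c hb hbc => by
    have := hadd b (c - b) hb (by linarith)
    rw [add_sub_cancel] at this
    linarith [hf (c - b) (by linarith)]
  have hmul : ∀ (k : ℕ) (b : ℝ), 0 ≤ b → f (k * b) = k * f b := by
    intro k b hb
    induction k with
    | zero =>
      have := hadd 0 0 le_rfl le_rfl
      rw [add_zero] at this
      rw [Nat.cast_zero, zero_mul, zero_mul]; linarith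
    | succ k ih =>
      rw [Nat.cast_succ, add_one_mul, hadd _ _ (by positivity) hb, ih, add_one_mul]
  -- compare `f (N a)` with the values of `f` at the integers next to `N a`
  have hbound : ∀ N : ℕ, N * |f a - f 1 * a| ≤ f 1 := by
    intro N
    have hNa : 0 ≤ N * a := by positivity
    have h1 := hmono _ _ (Nat.cast_nonneg _) (Nat.floor_le hNa)
    have h2 := hmono _ _ hNa (Nat.lt_floor_add_one (N * a)).le
    have h3 := hmul ⌊N * a⌋₊ 1 zero_le_one
    have h4 := hmul (⌊N * a⌋₊ + 1) 1 zero_le_one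
    rw [mul_one] at h3 h4
    push_cast at h4
    rw [h3, hmul N a ha] at h1
    rw [h4, hmul N a ha] at h2
    have hf1 := hf 1 zero_le_one
    have h5 := mul_le_mul_of_nonneg_right (Nat.floor_le hNa) hf1
    have h6 := mul_le_mul_of_nonneg_right (Nat.lt_floor_add_one (N * a)).le hf1
    rw [← Nat.abs_cast N, ← abs_mul, abs_le]
    constructor <;> nlinarith
  by_contra hne
  have hpos : 0 < |f a - f 1 * a| := abs_pos.2 (sub_ne_zero.2 hne)
  obtain ⟨N, hN⟩ := exists_nat_gt (f 1 / |f a - f 1 * a|)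
  rw [div_lt_iff₀ hpos] at hN
  exact absurd (hbound N) (not_le.2 hN)

theorem exists_muDS_sepNormals_eq {n : ℕ} (hn : 1 ≤ n) : ∃ c : ℝ, 0 < c ∧
    ∀ x ∈ Hyp n, ∀ y ∈ Hyp n, muDS n (sepNormals x y) = ENNReal.ofReal (c * hypDist x y) := by
  set j : Fin n := ⟨0, hn⟩
  set p : E n := Pi.single 0 1 with hp_def
  set v : E n := Pi.single j.succ 1 with hv_def
  have hp : p ∈ Hyp n := ⟨by simp [p, form], by simp [p]⟩
  have hpv : form p v = 0 := by simp [p, v, form]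
  have hv : form v v = 1 := by simp [v, form, Pi.single_apply]
  have hγ : ∀ t, geodesic p v t ∈ Hyp n := geodesic_mem_hyp hp hpv hv
  have hfin : ∀ d, muDS n (sepNormals p (geodesic p v d)) ≠ ⊤ := fun d =>
    (muDS_sepNormals_lt_top hn d).ne
  have hinv : ∀ {x y x' y' : E n}, x ∈ Hyp n → y ∈ Hyp n → x' ∈ Hyp n → y' ∈ Hyp n →
      form x y = form x' y' → muDS n (sepNormals x y) = muDS n (sepNormals x' y') := by
    intro x y x' y' hx hy hx' hy' h
    obtain ⟨g, rfl, rfl⟩ := exists_lorentz_apply_pair_eq hx hy hx' hy' h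
    exact (muDS_sepNormals_lorentz hn g x y).symm
  let F : ℝ → ℝ := fun d => (muDS n (sepNormals p (geodesic p v d))).toReal
  have hF0 : F 0 = 0 := by
    have : sepNormals p p = ∅ := by
      ext u
      simpa [sepNormals] using mul_self_nonneg (form p u)
    simp [F, geodesic_zero, this]
  have hadd : ∀ a b, 0 ≤ a → 0 ≤ b → F (a + b) = F a + F b := by
    intro a b ha hb
    rcases ha.eq_or_lt with rfl | ha
    · rw [hF0, zero_add, zero_add]
    rcases hb.eq_or_lt with rfl | hb
    · rw [hF0, add_zero, add_zero]
    have hs : 0 < Real.sinh (a + b) := Real.sinh_pos_iff.2 (by linarith)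
    have hcomb : geodesic p v a = (Real.sinh b / Real.sinh (a + b)) • p +
        (Real.sinh a / Real.sinh (a + b)) • geodesic p v (a + b) := by
      have h := sinh_smul_geodesic p v a (a + b)
      rw [add_sub_cancel_left] at h
      rw [div_eq_inv_mul, div_eq_inv_mul, mul_smul, mul_smul, ← smul_add, ← h, smul_smul,
        inv_mul_cancel₀ hs.ne', one_smul]
    have h1 := muDS_sepNormals_add hn (hγ a) (div_pos (Real.sinh_pos_iff.2 hb) hs)
      (div_pos (Real.sinh_pos_iff.2 ha) hs) hcomb
    have h2 : muDS n (sepNormals (geodesic p v a) (geodesic p v (a + b))) =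
        muDS n (sepNormals p (geodesic p v b)) := by
      refine hinv (hγ a) (hγ _) hp (hγ b) ?_
      have h3 := form_geodesic_geodesic hp hpv hv 0 b
      rw [geodesic_zero] at h3
      rw [form_geodesic_geodesic hp hpv hv, h3, add_sub_cancel_left, sub_zero]
    simp only [F]
    rw [h1, h2, ENNReal.toReal_add (hfin a) (hfin b)]
  refine ⟨F 1, ENNReal.toReal_pos (muDS_sepNormals_geodesic_pos hn hp hpv hv).ne' (hfin 1), ?_⟩
  intro x hx y hy
  have hcosh := cosh_hypDist hx hy
  have hd : 0 ≤ hypDist x y := Real.arcosh_nonneg (by rw [← hcosh]; exact Real.one_le_cosh _)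
  rw [← eq_mul_of_additive_of_nonneg hadd (fun _ _ => ENNReal.toReal_nonneg) hd,
    ENNReal.ofReal_toReal (hfin _)]
  refine hinv hx hy hp (hγ _) ?_
  have h3 := form_geodesic_geodesic hp hpv hv 0 (hypDist x y)
  rw [geodesic_zero, sub_zero, hcosh, neg_neg] at h3
  exact h3.symm

theorem preimage_separates {n : ℕ} {x y : E n} (hx : x ∈ Hyp n) (hy : y ∈ Hyp n) :
    toOm ⁻¹' {H : Om n | Separates (H : Set (E n)) x y} = sepNormals x y := by
  ext u
  exact separates_polar_iff hx hy

end HyperbolicWalls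

end

theorem mainTheorem1 (n : ℕ) (hn : 1 ≤ n) :
    -- `Ω` is identified with `dSⁿ/{±1}` through `u ↦ P_u`
    (∃ e : Quotient (signSetoid n) ≃ᵐ Om n,
      ∀ u : dS n, (e (Quotient.mk (signSetoid n) u) : Set (E n)) = polar (u : E n)) ∧
    -- `(r, ω) ↦ (sinh r, cosh r ω)` identifies `ℝ × S^{n-1}` with `dSⁿ`
    IsHomeomorph (param n) ∧
    -- `cosh^{n-1} r dr dω` is the volume measure of `dSⁿ`
    IsVolumeMeasure (muDS n) ∧
    -- it is invariant on `dSⁿ`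
    (∀ g : lorentzGroup n, MeasurePreserving (actDS g) (muDS n) (muDS n)) ∧
    -- the induced measure is invariant on `Ω`
    (∀ g : lorentzGroup n, ∃ φ : Om n → Om n,
      (∀ H : Om n, (φ H : Set (E n)) = actHyp g '' (H : Set (E n))) ∧
        MeasurePreserving φ (mu n) (mu n)) ∧
    -- the measure of the set of separating hyperplanes is proportional to the distance
    ∃ c : ℝ, 0 < c ∧ ∀ x ∈ Hyp n, ∀ y ∈ Hyp n,
      MeasurableSet {H : Om n | Separates (H : Set (E n)) x y} ∧
        mu n {H : Om n | Separates (H : Set (E n)) x y} = ENNReal.ofReal (c * hypDist x y) := by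

  refine ⟨⟨quotientEquivOm n, fun _ => rfl⟩, isHomeomorph_param n, isVolumeMeasure_muDS hn,
    measurePreserving_actDS hn, exists_measurePreserving_actOm hn, ?_⟩
  obtain ⟨c, hc, h⟩ := exists_muDS_sepNormals_eq hn
  refine ⟨c, hc, fun x hx y hy => ?_⟩
  have hm : MeasurableSet {H : Om n | Separates (H : Set (E n)) x y} := by
    change MeasurableSet (toOm ⁻¹' _)
    rw [preimage_separates hx hy]
    exact (isOpen_sepNormals x y).measurableSet
  refine ⟨hm, ?_⟩
  rw [mu, Measure.map_apply (measurable_toOm n) hm, preimage_separates hx hy, h x hx y hy]
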